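/- Let $\log$ be the principal logarithm and $\mathrm{Li}_2(z)=-\int_0^z\frac{\log(1-u)}{u}\,du$ the principal branch of the dilogarithm on $\mathbb{C}\setminus[1,\infty)$. For an integer $p\ge 6$ and $t,s\in\mathbb{C}$ put $$V(p,t,s)=\pi\sqrt{-1}\left((2p+1)s^2-(2p+3)s-2t\right)+\frac{1}{2\pi\sqrt{-1}}\left(\mathrm{Li}_2(e^{2\pi\sqrt{-1}(t+s)})+\mathrm{Li}_2(e^{2\pi\sqrt{-1}(t-s)})-3\,\mathrm{Li}_2(e^{2\pi\sqrt{-1}t})+\frac{\pi^2}{6}\right),$$ and let $$D_0'=\{(t,s)\in\mathbb{R}^2 : 0.02\le t-s\le 0.7,\ 1.02\le t+s\le 1.7,\ 0.2\le s\le 0.8,\ 0.5\le t\le 0.909\}.$$ Then for every integer $p\ge 6$ the function $V(p,\cdot,\cdot)$ has exactly one critical point $(t_0,s_0)\in\mathbb{C}^2$ (a point with $\partial V/\partial t=\partial V/\partial s=0$) such that $(\mathrm{Re}\,t_0,\mathrm{Re}\,s_0)\in D_0'$, and the real part $\zeta_{\mathbb{R}}(p)=\mathrm{Re}\,V(p,t_0,s_0)$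 of the critical value satisfies $$2\pi\,\zeta_{\mathbb{R}}(p)\ \ge\ v_8-\frac{49\pi^2}{64}\,\frac{1}{p^2},$$ where $v_8\approx 3.66386$ is the hyperbolic volume of the regular ideal octahedron. -/

import Mathlib

noncomputable section

namespace TwistKnot

/-- The dilogarithm `Li₂ z = -∫₀ᶻ log (1 - u) / u du`, integrated along the straight segment
`u = r z`, `0 ≤ r ≤ 1`, with the principal logarithm.  For `z` outside `[1, ∞)` the segment stays
in the simply connected domain `ℂ ∖ [1, ∞)`, so this is the principal branch. -/
def dilog (z : ℂ) : ℂ :=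
  -∫ r in (0 : ℝ)..1, Complex.log (1 - (r : ℂ) * z) / (r : ℂ)

/-- The potential function of the twist knot `K_p`,
`V(p,t,s) = πi((2p+1)s² - (2p+3)s - 2t)
  + (1/2πi) (Li₂(e^{2πi(t+s)}) + Li₂(e^{2πi(t-s)}) - 3 Li₂(e^{2πit}) + π²/6)`. -/
def potential (p : ℕ) (t s : ℂ) : ℂ :=
  (Real.pi : ℂ) * Complex.I *
      ((2 * (p : ℂ) + 1) * s ^ 2 - (2 * (p : ℂ) + 3) * s - 2 * t)
    + 1 / (2 * (Real.pi : ℂ) * Complex.I) *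
      (dilog (Complex.exp (2 * (Real.pi : ℂ) * Complex.I * (t + s)))
        + dilog (Complex.exp (2 * (Real.pi : ℂ) * Complex.I * (t - s)))
        - 3 * dilog (Complex.exp (2 * (Real.pi : ℂ) * Complex.I * t))
        + (Real.pi : ℂ) ^ 2 / 6)

/-- The region `D'₀` of the real `(t, s)`-plane in which the real part of the critical point is
required to lie. -/
def regionD₀ : Set (ℝ × ℝ) :=
  {q | 0.02 ≤ q.1 - q.2 ∧ q.1 - q.2 ≤ 0.7 ∧ 1.02 ≤ q.1 + q.2 ∧ q.1 + q.2 ≤ 1.7 ∧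
    0.2 ≤ q.2 ∧ q.2 ≤ 0.8 ∧ 0.5 ≤ q.1 ∧ q.1 ≤ 0.909}

/-- `(t, s) ∈ ℂ²` is a critical point of `V(p, ·, ·)`, i.e. both complex partial derivatives exist
and vanish there, and `(Re t, Re s)` lies in `D'₀`. -/
def IsCriticalPoint (p : ℕ) (t s : ℂ) : Prop :=
  (t.re, s.re) ∈ regionD₀ ∧
    HasDerivAt (fun t' : ℂ => potential p t' s) 0 t ∧
    HasDerivAt (fun s' : ℂ => potential p t s') 0 s

/-- The hyperbolic volume of a subset of the upper half-space model
`{(x, y, z) | 0 < z}` of hyperbolic 3-space, whose volume form is `dx dy dz / z³`. -/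
def hyperbolicVolume (S : Set (ℝ × ℝ × ℝ)) : ℝ :=
  ∫ q in S, 1 / q.2.2 ^ 3

/-- The regular ideal octahedron in the upper half-space model, with ideal vertices
`0, ∞, ±1, ±i` on the boundary sphere `ℂ ∪ {∞}` (the vertices of a regular octahedron inscribed in
the Riemann sphere).  The four faces at `∞` lie on the vertical planes `±x ± y = 1`; the four faces
at `0` lie on the hemispheres of radius `1/√2` centred at `(±1/2, ±1/2, 0)`, and the octahedron is
the region above the hemispheres and between the vertical planes. -/
def regularIdealOctahedron : Set (ℝ × ℝ × ℝ) :=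
  {q | 0 < q.2.2 ∧ |q.1| + |q.2.1| ≤ 1 ∧
    1 / 2 ≤ (|q.1| - 1 / 2) ^ 2 + (|q.2.1| - 1 / 2) ^ 2 + q.2.2 ^ 2}

/-- `v₈ ≈ 3.66386`, the volume of the regular ideal octahedron. -/
def v₈ : ℝ := hyperbolicVolume regularIdealOctahedron

end TwistKnot

end

open Complex Filter Topology MeasureTheory

namespace TwistKnot

/-! Write `s = 1/2 + θ/π`, `q = e^{iθ}`, `x = e^{2πit}`. Exponentiating `∂V/∂t = 0` gives `(1 - x)³
= (1 + xq²)(1 + xq⁻²)`, whose nonzero roots are `x = 1 ∓ 2i cos θ`; the range of `Re t` selects `x =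
1 - 2i cos θ`. On this curve the two logarithms in `∂V/∂s` differ by `3iθ + gd⁻¹(θ)`, with `gd⁻¹`
the inverse Gudermannian, so the second equation becomes `(4p - 1) θ = 2π - i gd⁻¹(θ)`. Since
`(gd⁻¹)' = 1/cos` is bounded by 2 on the strip `|Re θ| ≤ 0.3π`, this has at most one solution there,
and Banach's theorem gives one in `‖θ‖ ≤ 0.3` (`exists_fixedPoint`, `fixedPoint_unique`). The
equations between logarithms are recovered from their exponentials by bounding arguments
(`OnCurve.log_sub_log`, `OnCurve.log_triple`).

For the critical value, let `G` be the part of `2πV` on the curve that is free of `p`. The equation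
for `t` removes the derivative of `t(θ)`, so `G' = -2(3iθ + gd⁻¹(θ))`. Integrating near 0 and using
the fixed-point equation gives `2π Re V = Re G(0) + 2π Im θ + O(|θ|²)` with explicit constants,
where `|θ| = O(1/p)` and `Im θ ≥ -O(1/p²)` (`re_potential_ge`).

Finally `Re G(0) = v₈`. Integrating `Re G'` over the real segment `[0, π/2)`, at whose end `Re G`
tends to 0, expresses `Re G(0)` as a log-trigonometric integral (`re_curveG_zero`); computing the
octahedron's volume fibrewise in polar coordinates gives the same integral (`v₈_eq`). -/

/-! ### The dilogarithm: derivative off the cut and behaviour at the branch point. -/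

theorem one_sub_mul_mem_slitPlane {z : ℂ} (hz : 1 - z ∈ slitPlane) {r : ℝ} (h0 : 0 ≤ r)
    (h1 : r ≤ 1) : 1 - (r : ℂ) * z ∈ slitPlane := by
  have h := Complex.starConvex_one_slitPlane hz (sub_nonneg.2 h1) h0 (by ring)
  convert h using 1
  simp only [real_smul, ofReal_sub, ofReal_one]
  ring

theorem hasDerivAt_log_one_sub_mul {z : ℂ} {r : ℝ} (h : 1 - (r : ℂ) * z ∈ slitPlane) :
    HasDerivAt (fun r : ℝ => log (1 - (r : ℂ) * z)) (-z / (1 - (r : ℂ) * z)) r := by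
  have h1 : HasDerivAt (fun r : ℝ => 1 - (r : ℂ) * z) (-z) r := by
    simpa using ((Complex.ofRealCLM.hasDerivAt (x := r)).mul_const z).const_sub 1
  exact h1.clog_real h

theorem intervalIntegrable_dilog {z : ℂ} (hz : 1 - z ∈ slitPlane) :
    IntervalIntegrable (fun r : ℝ => log (1 - (r : ℂ) * z) / (r : ℂ)) volume 0 1 := by
  -- The singularity at `r = 0` is removable: `dslope` is the continuous extension of the integrand,
  -- which it equals on `(0, 1]`.
  have hc : ContinuousOn (dslope (fun r : ℝ => log (1 - (r : ℂ) * z)) 0) (Set.uIcc 0 1) := by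
    rw [Set.uIcc_of_le zero_le_one]
    intro r hr
    have hd := hasDerivAt_log_one_sub_mul (one_sub_mul_mem_slitPlane hz hr.1 hr.2)
    apply ContinuousAt.continuousWithinAt
    rcases eq_or_ne r 0 with rfl | h
    · exact continuousAt_dslope_same.2 hd.differentiableAt
    · exact (continuousAt_dslope_of_ne h).2 hd.continuousAt
  refine hc.intervalIntegrable.congr ?_
  intro r hr
  rw [Set.uIoc_of_le zero_le_one] at hr
  simp only [dslope_of_ne _ hr.1.ne', slope_def_module, real_smul]
  simp
  field_simp

theorem integral_inv_one_sub_mul {z : ℂ} (h0 : z ≠ 0) (hz : 1 - z ∈ slitPlane) :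
    ∫ r in (0 : ℝ)..1, -(1 - (r : ℂ) * z)⁻¹ = log (1 - z) / z := by
  have h := intervalIntegral.integral_eq_sub_of_hasDerivAt (a := 0) (b := 1)
    (f := fun r : ℝ => log (1 - (r : ℂ) * z) / z) (f' := fun r : ℝ => -(1 - (r : ℂ) * z)⁻¹) ?_ ?_
  · simpa using h
  · intro r hr
    rw [Set.uIcc_of_le zero_le_one] at hr
    refine ((hasDerivAt_log_one_sub_mul
      (one_sub_mul_mem_slitPlane hz hr.1 hr.2)).div_const z).congr_deriv ?_
    field_simp
  · apply ContinuousOn.intervalIntegrable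
    apply ContinuousOn.neg
    apply ContinuousOn.inv₀ (by fun_prop)
    intro r hr
    rw [Set.uIcc_of_le zero_le_one] at hr
    exact slitPlane_ne_zero (one_sub_mul_mem_slitPlane hz hr.1 hr.2)

theorem aestronglyMeasurable_dilog (z : ℂ) (μ : Measure ℝ) :
    AEStronglyMeasurable (fun r : ℝ => log (1 - (r : ℂ) * z) / (r : ℂ)) μ := by
  apply Measurable.aestronglyMeasurable
  fun_prop

/-- The dilogarithm is holomorphic off the cut `[1, ∞)`. -/
theorem hasDerivAt_dilog {z : ℂ} (h0 : z ≠ 0) (hz : 1 - z ∈ slitPlane) :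
    HasDerivAt dilog (-(log (1 - z) / z)) z := by
  have hopen : IsOpen {y : ℂ | 1 - y ∈ slitPlane} :=
    isOpen_slitPlane.preimage (by fun_prop)
  obtain ⟨ε, hε, hball⟩ := Metric.isOpen_iff.1 hopen z hz
  obtain ⟨r₀, hr₀, hmin⟩ := (isCompact_Icc (a := (0 : ℝ)) (b := 1)).exists_isMinOn ⟨0, by simp⟩
    (f := fun r : ℝ => ‖1 - (r : ℂ) * z‖) (by fun_prop)
  set m := ‖1 - (r₀ : ℂ) * z‖ with hm
  have hmpos : 0 < m := norm_pos_iff.2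
    (slitPlane_ne_zero (one_sub_mul_mem_slitPlane hz hr₀.1 hr₀.2))
  -- Differentiation under the integral sign. Moving `z` by less than `m / 2` leaves `|1 - r y| ≥ m
  -- / 2` for all `r` in `(0, 1]`, which gives the bound `2 / m`; the radius `ε` keeps `1 - y` in
  -- the slit plane.
  have key := intervalIntegral.hasDerivAt_integral_of_dominated_loc_of_deriv_le (μ := volume)
    (a := 0) (b := 1) (x₀ := z) (s := Metric.ball z (min ε (m / 2)))
    (F := fun y (r : ℝ) => log (1 - (r : ℂ) * y) / (r : ℂ))
    (F' := fun y (r : ℝ) => -(1 - (r : ℂ) * y)⁻¹) (bound := fun _ => 2 / m)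
    (Metric.ball_mem_nhds _ (by positivity))
    (Eventually.of_forall fun y => aestronglyMeasurable_dilog y _)
    (intervalIntegrable_dilog hz)
    (Measurable.aestronglyMeasurable (by fun_prop))
    (Eventually.of_forall fun r hr y hy => ?_)
    intervalIntegrable_const
    (Eventually.of_forall fun r hr y hy => ?_)
  · rw [integral_inv_one_sub_mul h0 hz] at key
    exact key.2.neg
  · rw [Set.uIoc_of_le zero_le_one] at hr
    have h1 : m ≤ ‖1 - (r : ℂ) * z‖ := hmin ⟨hr.1.le, hr.2⟩
    have hy' : ‖y - z‖ < m / 2 := by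
      have := lt_of_lt_of_le (Metric.mem_ball.1 hy) (min_le_right _ _)
      rwa [dist_eq] at this
    have h2 : ‖(r : ℂ) * (y - z)‖ ≤ m / 2 := by
      rw [norm_mul, norm_real, Real.norm_of_nonneg hr.1.le]
      nlinarith [norm_nonneg (y - z), hr.2, hr.1]
    have h3 : m / 2 ≤ ‖1 - (r : ℂ) * y‖ := by
      have := norm_sub_norm_le (1 - (r : ℂ) * z) ((r : ℂ) * (y - z))
      have e : 1 - (r : ℂ) * z - (r : ℂ) * (y - z) = 1 - (r : ℂ) * y := by ring
      rw [e] at this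
      linarith
    rw [norm_neg, norm_inv]
    calc ‖1 - (r : ℂ) * y‖⁻¹ ≤ (m / 2)⁻¹ := inv_anti₀ (by positivity) h3
      _ = 2 / m := by rw [inv_div]
  · rw [Set.uIoc_of_le zero_le_one] at hr
    have hys : 1 - y ∈ slitPlane := hball (Metric.ball_subset_ball (min_le_left _ _) hy)
    have hs := one_sub_mul_mem_slitPlane hys hr.1.le hr.2
    have h1 : HasDerivAt (fun y : ℂ => 1 - (r : ℂ) * y) (-(r : ℂ)) y := by
      simpa using ((hasDerivAt_id y).const_mul (r : ℂ)).const_sub 1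
    have hr0 : (r : ℂ) ≠ 0 := by exact_mod_cast hr.1.ne'
    refine ((h1.clog hs).div_const (r : ℂ)).congr_deriv ?_
    field_simp

/-- The imaginary part of the dilogarithm tends to `0` at the branch point `1`. -/
theorem tendsto_dilog_im {ι : Type*} {l : Filter ι} [l.IsCountablyGenerated] {f : ι → ℂ}
    (hf : Tendsto f l (𝓝 1)) (hs : ∀ᶠ i in l, 1 - f i ∈ slitPlane) :
    Tendsto (fun i => (dilog (f i)).im) l (𝓝 0) := by
  have him : ∀ᶠ i in l, -∫ r in (0 : ℝ)..1, (log (1 - (r : ℂ) * f i) / (r : ℂ)).im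
      = (dilog (f i)).im := by
    filter_upwards [hs] with i hi
    rw [dilog, neg_im]
    congr 1
    exact Complex.imCLM.intervalIntegral_comp_comm (intervalIntegrable_dilog hi)
  have hlim : Tendsto (fun i => ∫ r in (0 : ℝ)..1, (log (1 - (r : ℂ) * f i) / (r : ℂ)).im) l
      (𝓝 (∫ r in (0 : ℝ)..1, (0 : ℝ))) := by
    have hnorm : ∀ᶠ i in l, ‖f i‖ ≤ 3 / 2 := by
      have := hf.norm
      rw [norm_one] at this
      exact this.eventually (eventually_le_nhds (by norm_num))
    -- Taking imaginary parts turns the logarithm into an argument, which stays bounded at `r = 1`.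
    -- For `r ≥ 1/3` the integrand is at most `3π < 10`; for smaller `r`, `|log (1 + w)| ≤ 3/2 |w|`
    -- absorbs the factor `1 / r`.
    refine intervalIntegral.tendsto_integral_filter_of_dominated_convergence (fun _ => 10) ?_ ?_
      intervalIntegrable_const ?_
    · exact Eventually.of_forall fun i =>
        (Complex.continuous_im.comp_aestronglyMeasurable (aestronglyMeasurable_dilog (f i) _))
    · filter_upwards [hnorm] with i hi
      refine Eventually.of_forall fun r hr => ?_
      rw [Set.uIoc_of_le zero_le_one] at hr
      rcases le_total r (1 / 3) with h | h
      · refine (abs_im_le_norm _).trans ?_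
        have h1 : ‖-((r : ℂ) * f i)‖ ≤ r * (3 / 2) := by
          rw [norm_neg, norm_mul, norm_real, Real.norm_of_nonneg hr.1.le]
          exact mul_le_mul_of_nonneg_left hi hr.1.le
        have h2 := norm_log_one_add_half_le_self (z := -((r : ℂ) * f i)) (by linarith)
        rw [← sub_eq_add_neg] at h2
        rw [norm_div, norm_real, Real.norm_of_nonneg hr.1.le, div_le_iff₀ hr.1]
        linarith [hr.1]
      · rw [div_ofReal_im, log_im, Real.norm_eq_abs, abs_div, abs_of_pos hr.1, div_le_iff₀ hr.1]
        have := abs_arg_le_pi (1 - (r : ℂ) * f i)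
        have := Real.pi_lt_d2
        linarith
    · have h1 : ∀ᵐ r : ℝ, r ≠ 1 := by simp [ae_iff, measure_singleton]
      filter_upwards [h1] with r hr1 hr
      rw [Set.uIoc_of_le zero_le_one] at hr
      have hlt : r < 1 := lt_of_le_of_ne hr.2 hr1
      have hc : Tendsto (fun i => 1 - (r : ℂ) * f i) l (𝓝 (((1 - r : ℝ)) : ℂ)) := by
        have := (hf.const_mul (r : ℂ)).const_sub 1
        simpa using this
      have hsl : (((1 - r : ℝ)) : ℂ) ∈ slitPlane := by
        rw [ofReal_mem_slitPlane]; linarith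
      have h2 := ((hc.clog hsl).div_const (r : ℂ))
      have h3 := (continuous_im.tendsto _).comp h2
      have h4 : (log ((1 - r : ℝ) : ℂ) / (r : ℂ)).im = 0 := by
        rw [← ofReal_log (by linarith), ← ofReal_div, ofReal_im]
      rw [h4] at h3
      exact h3
  rw [intervalIntegral.integral_zero] at hlim
  have := hlim.neg
  rw [neg_zero] at this
  exact this.congr' him

/-! ### Logarithm and argument of `1 - e^{2πiz}`. -/

theorem one_sub_exp_mem_slitPlane {z : ℂ} (h0 : 0 < z.re) (h1 : z.re < 1) :
    1 - exp (2 * Real.pi * I * z) ∈ slitPlane := by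
  by_contra hcon
  rw [mem_slitPlane_iff, not_or, not_not] at hcon
  have hpi := Real.pi_pos
  have him : (2 * Real.pi * I * z).im = 2 * Real.pi * z.re := by simp
  simp only [sub_re, one_re, sub_im, one_im, exp_re, exp_im, him] at hcon
  set E := Real.exp (2 * Real.pi * I * z).re
  have hE : 0 < E := Real.exp_pos _
  have hsin : Real.sin (2 * Real.pi * z.re) = 0 := by
    have : E * Real.sin (2 * Real.pi * z.re) = 0 := by linarith [hcon.2]
    exact (mul_eq_zero.1 this).resolve_left hE.ne'
  have hcos : 0 < Real.cos (2 * Real.pi * z.re) := by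
    by_contra h
    nlinarith [hcon.1]
  rw [mul_assoc, mul_left_comm] at hsin hcos
  have h2 : Real.sin (Real.pi * z.re) > 0 :=
    Real.sin_pos_of_pos_of_lt_pi (by positivity) (by nlinarith)
  have e : Real.pi * (2 * z.re) = 2 * (Real.pi * z.re) := by ring
  rw [e] at hsin hcos
  rw [Real.sin_two_mul] at hsin
  have h3 : Real.cos (Real.pi * z.re) = 0 := by
    rcases mul_eq_zero.1 hsin with h | h
    · linarith
    · exact h
  rw [Real.cos_two_mul, h3] at hcos
  norm_num at hcos

theorem exp_two_pi_sub_int (z : ℂ) (n : ℤ) :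
    exp (2 * Real.pi * I * (z - n)) = exp (2 * Real.pi * I * z) := by
  rw [exp_eq_exp_iff_exists_int]
  exact ⟨-n, by push_cast; ring⟩

/-- The composite is 1-periodic in `f`, so any open unit strip between consecutive integers will do;
`n = 1` serves `t + s`, and `n = 0` serves `t - s` and `t`. -/
theorem hasDerivAt_dilog_exp {f : ℂ → ℂ} {f' z : ℂ} (hf : HasDerivAt f f' z) (n : ℤ)
    (h0 : n < (f z).re) (h1 : (f z).re < n + 1) :
    HasDerivAt (fun y => dilog (exp (2 * Real.pi * I * f y)))
      (-(2 * Real.pi * I * f' * log (1 - exp (2 * Real.pi * I * f z)))) z := by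
  have hs : 1 - exp (2 * Real.pi * I * f z) ∈ slitPlane := by
    rw [← exp_two_pi_sub_int (f z) n]
    apply one_sub_exp_mem_slitPlane <;> simp <;> linarith
  have hne := exp_ne_zero (2 * Real.pi * I * f z)
  have h := (hasDerivAt_dilog hne hs).comp z (hf.const_mul (2 * Real.pi * I)).cexp
  refine h.congr_deriv ?_
  field_simp

/-- For fixed `Re z` the point lies on the ray from 1 in the direction `e^{πi(2 Re z - 1)}`, so its
argument is between 0 and that of the direction. -/
theorem arg_one_sub_exp_of_le_half {z : ℂ} (h0 : 0 < z.re) (h1 : z.re ≤ 1 / 2) :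
    Real.pi * (2 * z.re - 1) ≤ arg (1 - exp (2 * Real.pi * I * z)) ∧
      arg (1 - exp (2 * Real.pi * I * z)) ≤ 0 := by
  have hpi := Real.pi_pos
  have hs := one_sub_exp_mem_slitPlane h0 (by linarith)
  have hi : (2 * Real.pi * I * z).im = 2 * Real.pi * z.re := by simp
  set w := 1 - exp (2 * Real.pi * I * z) with hw
  set ρ := Real.exp (2 * Real.pi * I * z).re
  have hρ : 0 < ρ := Real.exp_pos _
  have hre : w.re = 1 - ρ * Real.cos (2 * Real.pi * z.re) := by
    rw [hw, sub_re, one_re, exp_re, hi]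
  have him : w.im = -(ρ * Real.sin (2 * Real.pi * z.re)) := by
    rw [hw, sub_im, one_im, exp_im, hi, zero_sub]
  have hsin : 0 ≤ Real.sin (2 * Real.pi * z.re) :=
    Real.sin_nonneg_of_nonneg_of_le_pi (by positivity) (by nlinarith)
  have hle : arg w ≤ 0 := by
    by_contra h
    push Not at h
    have h2 : arg w < Real.pi := lt_of_le_of_ne (arg_le_pi w) (slitPlane_arg_ne_pi hs)
    have h3 := Real.sin_pos_of_pos_of_lt_pi h h2
    have h4 := norm_mul_sin_arg w
    have h5 : 0 < ‖w‖ := norm_pos_iff.2 (slitPlane_ne_zero hs)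
    have : 0 < w.im := by rw [← h4]; positivity
    nlinarith
  refine ⟨?_, hle⟩
  by_contra h
  push Not at h
  have hgt := neg_pi_lt_arg w
  have h3 : Real.sin (arg w - Real.pi * (2 * z.re - 1)) < 0 :=
    Real.sin_neg_of_neg_of_neg_pi_lt (by linarith) (by nlinarith)
  have e : arg w - Real.pi * (2 * z.re - 1) = arg w - 2 * Real.pi * z.re + Real.pi := by ring
  rw [e, Real.sin_add_pi, Real.sin_sub] at h3
  have h4 := norm_mul_sin_arg w
  have h6 := norm_mul_cos_arg w
  have h5 : 0 < ‖w‖ := norm_pos_iff.2 (slitPlane_ne_zero hs)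
  have h7 : ‖w‖ * (Real.sin (arg w) * Real.cos (2 * Real.pi * z.re)
      - Real.cos (arg w) * Real.sin (2 * Real.pi * z.re)) = -Real.sin (2 * Real.pi * z.re) := by
    linear_combination Real.cos (2 * Real.pi * z.re) * h4 - Real.sin (2 * Real.pi * z.re) * h6
      + Real.cos (2 * Real.pi * z.re) * him - Real.sin (2 * Real.pi * z.re) * hre
  nlinarith

theorem arg_one_sub_exp_of_half_le {z : ℂ} (h0 : 1 / 2 ≤ z.re) (h1 : z.re < 1) :
    0 ≤ arg (1 - exp (2 * Real.pi * I * z)) ∧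
      arg (1 - exp (2 * Real.pi * I * z)) ≤ Real.pi * (2 * z.re - 1) := by
  have hs := one_sub_exp_mem_slitPlane (z := z) (by linarith) h1
  -- The reflection `z ↦ 1 - z̄` conjugates `1 - e^{2πiz}`, which reduces this half of the strip to
  -- the other.
  have h := arg_one_sub_exp_of_le_half (z := 1 - starRingEnd ℂ z) (by simp; linarith)
    (by simp; linarith)
  have e : 1 - exp (2 * Real.pi * I * (1 - starRingEnd ℂ z))
      = starRingEnd ℂ (1 - exp (2 * Real.pi * I * z)) := by
    rw [map_sub, map_one, ← exp_conj]
    simp only [map_mul, conj_I, conj_ofReal, map_ofNat]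
    congr 1
    rw [exp_eq_exp_iff_exists_int]
    exact ⟨1, by push_cast; ring⟩
  rw [e, arg_conj, if_neg (slitPlane_arg_ne_pi hs)] at h
  simp only [sub_re, one_re, conj_re] at h
  constructor <;> linarith [h.1, h.2]

/-! ### The inverse Gudermannian function on the strip `|Re z| < π/2`. -/

theorem cos_re' (z : ℂ) : (cos z).re = Real.cos z.re * Real.cosh z.im := by
  rw [Complex.cos_eq z]
  simp [← ofReal_cos, ← ofReal_sin, ← ofReal_cosh, ← ofReal_sinh]

theorem cos_im' (z : ℂ) : (cos z).im = -(Real.sin z.re * Real.sinh z.im) := by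
  rw [Complex.cos_eq z]
  simp [← ofReal_cos, ← ofReal_sin, ← ofReal_cosh, ← ofReal_sinh]

theorem sin_re' (z : ℂ) : (sin z).re = Real.sin z.re * Real.cosh z.im := by
  rw [Complex.sin_eq z]
  simp [← ofReal_cos, ← ofReal_sin, ← ofReal_cosh, ← ofReal_sinh]

theorem sin_im' (z : ℂ) : (sin z).im = Real.cos z.re * Real.sinh z.im := by
  rw [Complex.sin_eq z]
  simp [← ofReal_cos, ← ofReal_sin, ← ofReal_cosh, ← ofReal_sinh]

theorem cos_re_pos {z : ℂ} (h : |z.re| < Real.pi / 2) : 0 < (cos z).re := by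
  rw [abs_lt] at h
  rw [cos_re']
  exact mul_pos (Real.cos_pos_of_mem_Ioo ⟨h.1, h.2⟩) (Real.cosh_pos _)

theorem cos_ne_zero_of_abs_re {z : ℂ} (h : |z.re| < Real.pi / 2) : cos z ≠ 0 := by
  intro h0
  have := cos_re_pos h
  rw [h0] at this
  simp at this

/-- With `z = x + iy`, the real part of `(1 + sin z)` times the conjugate of `cos z` is `cos x (cosh
y + sin x)`. Positivity makes the principal logarithm holomorphic here and keeps its imaginary part
within `π/2`. -/
theorem one_add_sin_div_cos_re_pos {z : ℂ} (h : |z.re| < Real.pi / 2) :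
    0 < ((1 + sin z) / cos z).re := by
  have hn : 0 < normSq (cos z) := normSq_pos.2 (cos_ne_zero_of_abs_re h)
  have h' := abs_lt.1 h
  have hc : 0 < Real.cos z.re := Real.cos_pos_of_mem_Ioo ⟨h'.1, h'.2⟩
  have hs : -1 < Real.sin z.re := by
    nlinarith [Real.sin_sq_add_cos_sq z.re, Real.neg_one_le_sin z.re]
  have hch := Real.one_le_cosh z.im
  rw [div_re, ← add_div]
  apply div_pos _ hn
  simp only [add_re, add_im, one_re, one_im, sin_re', sin_im', cos_re', cos_im']
  have e := Real.cosh_sq z.im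
  have : (1 + Real.sin z.re * Real.cosh z.im) * (Real.cos z.re * Real.cosh z.im)
      + (0 + Real.cos z.re * Real.sinh z.im) * -(Real.sin z.re * Real.sinh z.im)
      = Real.cos z.re * (Real.cosh z.im + Real.sin z.re) := by
    linear_combination Real.sin z.re * Real.cos z.re * e
  rw [this]
  exact mul_pos hc (by linarith)

/-- The inverse Gudermannian function, holomorphic on the strip `|Re z| < π / 2`. -/
noncomputable def invGd (z : ℂ) : ℂ := log ((1 + sin z) / cos z)

theorem invGd_zero : invGd 0 = 0 := by simp [invGd]

theorem exp_invGd {z : ℂ} (h : |z.re| < Real.pi / 2) :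
    exp (invGd z) = (1 + sin z) / cos z := by
  apply exp_log
  intro h0
  have := one_add_sin_div_cos_re_pos h
  rw [h0] at this
  simp at this

theorem abs_invGd_im_lt {z : ℂ} (h : |z.re| < Real.pi / 2) : |(invGd z).im| < Real.pi / 2 := by
  rw [invGd, log_im, abs_arg_lt_pi_div_two_iff]
  exact Or.inl (one_add_sin_div_cos_re_pos h)

theorem hasDerivAt_invGd {z : ℂ} (h : |z.re| < Real.pi / 2) :
    HasDerivAt invGd (1 / cos z) z := by
  have hc := cos_ne_zero_of_abs_re h
  have hp := one_add_sin_div_cos_re_pos h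
  have hs : 1 + sin z ≠ 0 := by
    intro h0
    rw [h0] at hp
    simp at hp
  have h1 := (((hasDerivAt_sin z).const_add 1).div (hasDerivAt_cos z) hc).clog
    (mem_slitPlane_iff.2 (Or.inl hp))
  refine h1.congr_deriv ?_
  have := sin_sq_add_cos_sq z
  simp only [Pi.div_apply]
  field_simp
  linear_combination this

theorem half_le_norm_cos {z : ℂ} (h : |z.re| ≤ 0.3 * Real.pi) : 1 / 2 ≤ ‖cos z‖ := by
  have hpi := Real.pi_pos
  have h1 : 1 / 2 ≤ Real.cos z.re := by
    rw [← Real.cos_pi_div_three, ← Real.cos_abs z.re]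
    apply Real.cos_le_cos_of_nonneg_of_le_pi (abs_nonneg _) <;> linarith
  have h2 := (re_le_norm (cos z))
  rw [cos_re'] at h2
  nlinarith [Real.one_le_cosh z.im]

theorem convex_strip (c : ℝ) : Convex ℝ {z : ℂ | |z.re| ≤ c} := by
  have : {z : ℂ | |z.re| ≤ c} = Complex.reCLM ⁻¹' (Set.Icc (-c) c) := by
    ext z; simp [abs_le]
  rw [this]
  exact (convex_Icc _ _).linear_preimage Complex.reCLM.toLinearMap

theorem norm_invGd_sub_le {z w : ℂ} (hz : |z.re| ≤ 0.3 * Real.pi) (hw : |w.re| ≤ 0.3 * Real.pi) :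
    ‖invGd w - invGd z‖ ≤ 2 * ‖w - z‖ := by
  have hpi := Real.pi_pos
  refine Convex.norm_image_sub_le_of_norm_hasDerivWithin_le (s := {z : ℂ | |z.re| ≤ 0.3 * Real.pi})
    (f' := fun z => 1 / cos z)
    (fun y hy => (hasDerivAt_invGd (lt_of_le_of_lt hy (by linarith))).hasDerivWithinAt)
    (fun y hy => ?_) (convex_strip _) hz hw
  have := half_le_norm_cos hy
  rw [norm_div, norm_one, div_le_iff₀ (by linarith)]
  linarith

theorem norm_cos_sub_one_le {z : ℂ} (h : ‖z‖ ≤ 0.3) : ‖cos z - 1‖ ≤ 0.05 := by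
  have h1 := cos_bound (x := z) (by linarith)
  have h2 : ‖cos z - 1‖ ≤ ‖cos z - (1 - z ^ 2 / 2)‖ + ‖z ^ 2 / 2‖ := by
    have := norm_sub_le (cos z - (1 - z ^ 2 / 2)) (z ^ 2 / 2)
    rwa [show cos z - (1 - z ^ 2 / 2) - z ^ 2 / 2 = cos z - 1 by ring] at this
  rw [norm_div, norm_pow] at h2
  simp only [Complex.norm_ofNat] at h2
  have h0 := norm_nonneg z
  have h3 : ‖z‖ ^ 2 ≤ 0.09 := by nlinarith
  have h4 : ‖z‖ ^ 4 ≤ 0.0081 := by nlinarith [sq_nonneg (‖z‖ ^ 2)]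
  linarith

theorem norm_sec_sub_one_le {z : ℂ} (h : ‖z‖ ≤ 0.3) : ‖1 / cos z - 1‖ ≤ 0.06 := by
  have h1 := norm_cos_sub_one_le h
  have h2 : 0.95 ≤ ‖cos z‖ := by
    have := norm_sub_norm_le (1 : ℂ) (1 - cos z)
    rw [norm_one, sub_sub_cancel, norm_sub_rev] at this
    linarith
  have h0 : cos z ≠ 0 := by
    intro h0
    rw [h0] at h2
    norm_num at h2
  have e : 1 / cos z - 1 = -(cos z - 1) / cos z := by
    field_simp
    ring
  rw [e, norm_div, norm_neg, div_le_iff₀ (by linarith)]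
  linarith

theorem abs_re_lt_of_norm_le {z : ℂ} (h : ‖z‖ ≤ 0.3) : |z.re| < Real.pi / 2 := by
  have := abs_re_le_norm z
  have := Real.pi_gt_three
  linarith

theorem norm_invGd_sub_self_le {z : ℂ} (h : ‖z‖ ≤ 0.3) : ‖invGd z - z‖ ≤ 0.06 * ‖z‖ := by
  have := Convex.norm_image_sub_le_of_norm_hasDerivWithin_le (s := Metric.closedBall (0 : ℂ) 0.3)
    (f := fun z => invGd z - z) (f' := fun z => 1 / cos z - 1) (C := 0.06) (x := 0) (y := z)
    (fun y hy => ((hasDerivAt_invGd (abs_re_lt_of_norm_le (mem_closedBall_zero_iff.1 hy))).sub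
      (hasDerivAt_id y)).hasDerivWithinAt)
    (fun y hy => norm_sec_sub_one_le (mem_closedBall_zero_iff.1 hy)) (convex_closedBall _ _)
    (by simp; norm_num) (mem_closedBall_zero_iff.2 h)
  simpa [invGd_zero] using this

theorem norm_invGd_le {z : ℂ} (h : ‖z‖ ≤ 0.3) : ‖invGd z‖ ≤ 1.06 * ‖z‖ := by
  have := norm_invGd_sub_self_le h
  have h2 := norm_add_le (invGd z - z) z
  rw [sub_add_cancel] at h2
  linarith

/-! ### The fixed-point equation. -/

/-- For `N ≥ 23` the equation `N z = 2π - i gd⁻¹(z)` has a solution near `0`. -/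
theorem exists_fixedPoint {N : ℝ} (hN : 23 ≤ N) :
    ∃ z : ℂ, ‖z‖ ≤ 0.3 ∧ N * z = 2 * Real.pi - I * invGd z := by
  have hpi := Real.pi_lt_d2
  have hpi0 := Real.pi_pos
  have hN0 : (N : ℂ) ≠ 0 := by exact_mod_cast (by linarith : N ≠ 0)
  have hnorm : ‖(N : ℂ)‖ = N := by rw [norm_real, Real.norm_of_nonneg (by linarith)]
  let f : ℂ → ℂ := fun z => (2 * Real.pi - I * invGd z) / N
  -- The value of `N` enters here: `2π + 1.06 · 0.3 < 6.9 = 23 · 0.3`.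
  have hmaps : Set.MapsTo f (Metric.closedBall 0 0.3) (Metric.closedBall 0 0.3) := by
    intro z hz
    rw [mem_closedBall_zero_iff] at hz ⊢
    simp only [f]
    rw [norm_div, hnorm, div_le_iff₀ (by linarith)]
    have h1 := norm_sub_le (2 * Real.pi : ℂ) (I * invGd z)
    have h2 := norm_invGd_le hz
    have h3 : ‖(2 * Real.pi : ℂ)‖ = 2 * Real.pi := by
      simp [abs_of_pos hpi0]
    rw [h3, norm_mul I, norm_I, one_mul] at h1
    linarith
  have hstrip : ∀ z : ℂ, ‖z‖ ≤ 0.3 → |z.re| ≤ 0.3 * Real.pi := fun z hz => by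
    have := abs_re_le_norm z
    have := Real.pi_gt_three
    linarith
  have hlip : ContractingWith (1 / 2) (hmaps.restrict f _ _) := by
    refine ⟨by rw [← NNReal.coe_lt_coe]; norm_num, LipschitzWith.of_dist_le_mul ?_⟩
    rintro ⟨x, hx⟩ ⟨y, hy⟩
    rw [mem_closedBall_zero_iff] at hx hy
    rw [Subtype.dist_eq, Subtype.dist_eq]
    simp only [Set.MapsTo.val_restrict_apply, f, dist_eq]
    rw [← sub_div, norm_div, hnorm, div_le_iff₀ (by linarith)]
    have h1 := norm_invGd_sub_le (hstrip x hx) (hstrip y hy)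
    have e : 2 * (Real.pi : ℂ) - I * invGd x - (2 * Real.pi - I * invGd y)
      = I * (invGd y - invGd x) := by ring
    rw [e, norm_mul, norm_I, one_mul]
    rw [norm_sub_rev y x] at h1
    push_cast
    nlinarith [norm_nonneg (x - y)]
  obtain ⟨z, hz, hfix, -⟩ := ContractingWith.exists_fixedPoint' (s := Metric.closedBall (0 : ℂ) 0.3)
    Metric.isClosed_closedBall.isComplete hmaps hlip (x := 0)
    (by rw [mem_closedBall_zero_iff]; norm_num) (edist_ne_top _ _)
  refine ⟨z, mem_closedBall_zero_iff.1 hz, ?_⟩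
  have h : (2 * Real.pi - I * invGd z) / N = z := hfix
  rw [div_eq_iff hN0] at h
  rw [h]; ring

/-- Uniqueness is needed on the whole strip, not just on the disc of existence: the region bounds
`Re s` but says nothing about `Im s`. The Lipschitz constant 2 is still below `N`. -/
theorem fixedPoint_unique {N : ℝ} (hN : 23 ≤ N) {z w : ℂ} (hz : |z.re| ≤ 0.3 * Real.pi)
    (hw : |w.re| ≤ 0.3 * Real.pi) (hfz : N * z = 2 * Real.pi - I * invGd z)
    (hfw : N * w = 2 * Real.pi - I * invGd w) : z = w := by
  have h1 := norm_invGd_sub_le hz hw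
  have e : (N : ℂ) * (w - z) = -I * (invGd w - invGd z) := by
    linear_combination hfw - hfz
  have h2 := congrArg norm e
  rw [norm_mul, norm_mul, norm_neg, norm_I, one_mul, norm_real,
    Real.norm_of_nonneg (by linarith)] at h2
  have h3 : ‖w - z‖ = 0 := by nlinarith [norm_nonneg (w - z)]
  rw [norm_eq_zero, sub_eq_zero] at h3
  exact h3.symm

/-! ### The curve `e^{2πit} = 1 - 2i cos θ` and the logarithms along it. -/

/-- The points `(t, 1/2 + θ/π)` on the curve `e^{2πit} = 1 - 2i cos θ`, in the range where all
logarithms in the critical point equations are principal. -/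
structure OnCurve (t θ : ℂ) : Prop where
  exp_eq : exp (2 * Real.pi * I * t) = 1 - 2 * I * cos θ
  half_le : 1 / 2 ≤ t.re
  lt_one : t.re < 1
  abs_re_lt : |θ.re| < Real.pi / 2
  lt_add : 1 / 2 < t.re + θ.re / Real.pi
  lt_sub : 1 / 2 < t.re - θ.re / Real.pi

theorem exp_add_half (t θ : ℂ) : exp (2 * Real.pi * I * (t + (1 / 2 + θ / Real.pi)))
    = -(exp (2 * Real.pi * I * t) * exp (I * θ) ^ 2) := by
  have hpi : (Real.pi : ℂ) ≠ 0 := by exact_mod_cast Real.pi_ne_zero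
  rw [show 2 * Real.pi * I * (t + (1 / 2 + θ / Real.pi))
    = 2 * Real.pi * I * t + (I * θ + I * θ) + Real.pi * I by field_simp; ring]
  rw [exp_add_pi_mul_I, exp_add, exp_add]
  ring

theorem exp_sub_half (t θ : ℂ) : exp (2 * Real.pi * I * (t - (1 / 2 + θ / Real.pi)))
    = -(exp (2 * Real.pi * I * t) * (exp (I * θ))⁻¹ ^ 2) := by
  have hpi : (Real.pi : ℂ) ≠ 0 := by exact_mod_cast Real.pi_ne_zero
  rw [show 2 * Real.pi * I * (t - (1 / 2 + θ / Real.pi))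
    = 2 * Real.pi * I * t + (-(I * θ) + -(I * θ)) - Real.pi * I by field_simp; ring]
  rw [exp_sub_pi_mul_I, exp_add, exp_add, exp_neg]
  ring

theorem two_cos_eq (θ : ℂ) : 2 * cos θ = exp (I * θ) + (exp (I * θ))⁻¹ := by
  rw [two_cos, ← exp_neg]
  congr 2 <;> ring

theorem two_sin_eq (θ : ℂ) : 2 * sin θ = ((exp (I * θ))⁻¹ - exp (I * θ)) * I := by
  rw [two_sin, ← exp_neg]
  congr 3 <;> ring

/-- With `q = e^{iθ}`, `1 + (1 - 2i cos θ)q² = (1 + q²)(1 - iq)`, and the other factor is the same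
with `q⁻¹` for `q`. Their quotient is `q³(1 - iq)/(q - i)`, and `(1 - iq)/(q - i) = (1 + sin θ)/cos
θ`. -/
theorem factor_ratio (θ : ℂ) :
    (1 + (1 - 2 * I * cos θ) * exp (I * θ) ^ 2) * cos θ
      = (1 + (1 - 2 * I * cos θ) * (exp (I * θ))⁻¹ ^ 2) * (exp (I * θ) ^ 3 * (1 + sin θ)) := by
  have hc : cos θ = (exp (I * θ) + (exp (I * θ))⁻¹) / 2 := by rw [← two_cos_eq]; ring
  have hs : sin θ = ((exp (I * θ))⁻¹ - exp (I * θ)) * I / 2 := by rw [← two_sin_eq]; ring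
  have hq := exp_ne_zero (I * θ)
  rw [hc, hs]
  generalize exp (I * θ) = q at *
  have hI := I_sq
  field_simp
  ring_nf
  simp only [I_sq]
  ring

theorem factor_prod (θ : ℂ) :
    (1 + (1 - 2 * I * cos θ) * exp (I * θ) ^ 2)
      * (1 + (1 - 2 * I * cos θ) * (exp (I * θ))⁻¹ ^ 2) = (2 * I * cos θ) ^ 3 := by
  have hc : cos θ = (exp (I * θ) + (exp (I * θ))⁻¹) / 2 := by rw [← two_cos_eq]; ring
  have hq := exp_ne_zero (I * θ)
  rw [hc]
  generalize exp (I * θ) = q at *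
  have hI := I_sq
  field_simp
  ring_nf
  simp only [show I ^ 3 = -I by rw [pow_succ, I_sq]; ring, I_sq]
  ring

namespace OnCurve

variable {t θ : ℂ}

theorem abs_sigma_lt (h : OnCurve t θ) : |θ.re / Real.pi| < 1 / 2 := by
  rw [abs_div, abs_of_pos Real.pi_pos, div_lt_iff₀ Real.pi_pos]
  linarith [h.abs_re_lt]

theorem exp_shift (t s : ℂ) :
    exp (2 * Real.pi * I * (t + s - 1)) = exp (2 * Real.pi * I * (t + s)) := by
  simpa using exp_two_pi_sub_int (t + s) 1

theorem re_plus (t θ : ℂ) :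
    (t + (1 / 2 + θ / Real.pi) - 1).re = t.re + θ.re / Real.pi - 1 / 2 := by
  simp only [sub_re, add_re, div_ofReal_re, one_re]
  norm_num
  ring

theorem re_minus (t θ : ℂ) :
    (t - (1 / 2 + θ / Real.pi)).re = t.re - θ.re / Real.pi - 1 / 2 := by
  simp only [sub_re, add_re, div_ofReal_re]
  norm_num
  ring

theorem plus_ne (h : OnCurve t θ) :
    1 - exp (2 * Real.pi * I * (t + (1 / 2 + θ / Real.pi))) ≠ 0 := by
  have hσ := abs_lt.1 h.abs_sigma_lt
  rw [← exp_shift]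
  apply slitPlane_ne_zero
  apply one_sub_exp_mem_slitPlane <;> rw [re_plus]
  · linarith [h.lt_add]
  · linarith [h.lt_one]

theorem minus_ne (h : OnCurve t θ) :
    1 - exp (2 * Real.pi * I * (t - (1 / 2 + θ / Real.pi))) ≠ 0 := by
  have hσ := abs_lt.1 h.abs_sigma_lt
  apply slitPlane_ne_zero
  apply one_sub_exp_mem_slitPlane <;> rw [re_minus]
  · linarith [h.lt_sub]
  · linarith [h.lt_one]

theorem arg_plus (h : OnCurve t θ) :
    (t.re + θ.re / Real.pi ≤ 1 →
      2 * Real.pi * (t.re + θ.re / Real.pi - 1)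
        ≤ arg (1 - exp (2 * Real.pi * I * (t + (1 / 2 + θ / Real.pi)))) ∧
      arg (1 - exp (2 * Real.pi * I * (t + (1 / 2 + θ / Real.pi)))) ≤ 0) ∧
    (1 ≤ t.re + θ.re / Real.pi →
      0 ≤ arg (1 - exp (2 * Real.pi * I * (t + (1 / 2 + θ / Real.pi)))) ∧
      arg (1 - exp (2 * Real.pi * I * (t + (1 / 2 + θ / Real.pi))))
        ≤ 2 * Real.pi * (t.re + θ.re / Real.pi - 1)) := by
  have hσ := abs_lt.1 h.abs_sigma_lt
  rw [← exp_shift]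
  have e := re_plus t θ
  refine ⟨fun h1 => ?_, fun h1 => ?_⟩
  · have := arg_one_sub_exp_of_le_half (by rw [e]; linarith [h.lt_add]) (by rw [e]; linarith)
    rw [e] at this
    exact ⟨by linarith [this.1], this.2⟩
  · have := arg_one_sub_exp_of_half_le (by rw [e]; linarith) (by rw [e]; linarith [h.lt_one])
    rw [e] at this
    exact ⟨this.1, by linarith [this.2]⟩

theorem arg_minus (h : OnCurve t θ) :
    (t.re - θ.re / Real.pi ≤ 1 →
      2 * Real.pi * (t.re - θ.re / Real.pi - 1)
        ≤ arg (1 - exp (2 * Real.pi * I * (t - (1 / 2 + θ / Real.pi)))) ∧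
      arg (1 - exp (2 * Real.pi * I * (t - (1 / 2 + θ / Real.pi)))) ≤ 0) ∧
    (1 ≤ t.re - θ.re / Real.pi →
      0 ≤ arg (1 - exp (2 * Real.pi * I * (t - (1 / 2 + θ / Real.pi)))) ∧
      arg (1 - exp (2 * Real.pi * I * (t - (1 / 2 + θ / Real.pi))))
        ≤ 2 * Real.pi * (t.re - θ.re / Real.pi - 1)) := by
  have hσ := abs_lt.1 h.abs_sigma_lt
  have e := re_minus t θ
  refine ⟨fun h1 => ?_, fun h1 => ?_⟩
  · have := arg_one_sub_exp_of_le_half (by rw [e]; linarith [h.lt_sub]) (by rw [e]; linarith)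
    rw [e] at this
    exact ⟨by linarith [this.1], this.2⟩
  · have := arg_one_sub_exp_of_half_le (by rw [e]; linarith) (by rw [e]; linarith [h.lt_one])
    rw [e] at this
    exact ⟨this.1, by linarith [this.2]⟩

/-- The difference of the two logarithms in `∂V/∂s`. -/
theorem log_sub_log (h : OnCurve t θ) :
    log (1 - exp (2 * Real.pi * I * (t + (1 / 2 + θ / Real.pi))))
      - log (1 - exp (2 * Real.pi * I * (t - (1 / 2 + θ / Real.pi))))
      = 3 * I * θ + invGd θ := by
  have hpi := Real.pi_pos
  have hexp : exp (log (1 - exp (2 * Real.pi * I * (t + (1 / 2 + θ / Real.pi))))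
      - log (1 - exp (2 * Real.pi * I * (t - (1 / 2 + θ / Real.pi)))))
      = exp (3 * I * θ + invGd θ) := by
    rw [exp_sub, exp_log h.plus_ne, exp_log h.minus_ne, exp_add, exp_invGd h.abs_re_lt,
      div_eq_iff h.minus_ne, exp_add_half, exp_sub_half, h.exp_eq]
    have hc := cos_ne_zero_of_abs_re h.abs_re_lt
    have e3 : exp (3 * I * θ) = exp (I * θ) ^ 3 := by rw [← exp_nat_mul]; push_cast; ring_nf
    have := factor_ratio θ
    rw [e3]
    field_simp
    rw [inv_pow] at this
    field_simp at this
    linear_combination this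
  obtain ⟨k, hk⟩ := exp_eq_exp_iff_exists_int.1 hexp
  have him := congrArg Complex.im hk
  have i1 : ((k : ℂ) * (2 * Real.pi * I)).im = 2 * Real.pi * k := by simp; ring
  have i2 : (3 * I * θ).im = 3 * θ.re := by simp
  rw [sub_im, add_im, add_im, log_im, log_im, i1, i2] at him
  have hL := abs_lt.1 (abs_invGd_im_lt h.abs_re_lt)
  have hσ := abs_lt.1 h.abs_sigma_lt
  have hθ : θ.re = Real.pi * (θ.re / Real.pi) := by field_simp
  have h1 := h.half_le
  have h2 := h.lt_one
  have hP := h.arg_plus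
  have hM := h.arg_minus
  set σ := θ.re / Real.pi
  set β := arg (1 - exp (2 * Real.pi * I * (t + (1 / 2 + θ / Real.pi))))
  set γ := arg (1 - exp (2 * Real.pi * I * (t - (1 / 2 + θ / Real.pi))))
  -- The two sides can differ only by `2πik`. The brackets on the arguments, the bound `π/2` on the
  -- imaginary part of `invGd θ` and the range of `t` force `|k| < 1`.
  have hk0 : k = 0 := by
    have hlt : (k : ℝ) < 1 ∧ -1 < (k : ℝ) := by
      rcases le_total (t.re + σ) 1 with ha | ha
      · have hb := hP.1 ha
        rcases le_total (t.re - σ) 1 with hc | hc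
        · have hd := hM.1 hc
          constructor <;> nlinarith
        · have hd := hM.2 hc
          constructor <;> nlinarith
      · have hb := hP.2 ha
        have hd := hM.1 (by linarith)
        constructor <;> nlinarith
    have a1 : k < 1 := by exact_mod_cast hlt.1
    have a2 : -1 < k := by exact_mod_cast hlt.2
    omega
  rw [hk, hk0]
  simp

/-- The equation `∂V/∂t = 0` along the curve. -/
theorem log_triple (h : OnCurve t θ)
    (harg : Real.pi / 3 ≤ arg (1 - exp (2 * Real.pi * I * t))) :
    3 * log (1 - exp (2 * Real.pi * I * t))
      - log (1 - exp (2 * Real.pi * I * (t + (1 / 2 + θ / Real.pi))))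
      - log (1 - exp (2 * Real.pi * I * (t - (1 / 2 + θ / Real.pi)))) = 2 * Real.pi * I := by
  have hpi := Real.pi_pos
  have hx : 1 - exp (2 * Real.pi * I * t) = 2 * I * cos θ := by rw [h.exp_eq]; ring
  have hx0 : 1 - exp (2 * Real.pi * I * t) ≠ 0 := by
    rw [hx]
    simpa using cos_ne_zero_of_abs_re h.abs_re_lt
  have hexp : exp (3 * log (1 - exp (2 * Real.pi * I * t))
      - log (1 - exp (2 * Real.pi * I * (t + (1 / 2 + θ / Real.pi))))
      - log (1 - exp (2 * Real.pi * I * (t - (1 / 2 + θ / Real.pi))))) = exp 0 := by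
    have e3 : exp (3 * log (1 - exp (2 * Real.pi * I * t)))
        = (1 - exp (2 * Real.pi * I * t)) ^ 3 := by
      rw [← exp_log hx0, ← exp_nat_mul, exp_log hx0]; push_cast; rfl
    rw [exp_sub, exp_sub, exp_log h.plus_ne, exp_log h.minus_ne, e3, exp_zero, div_div,
      div_eq_one_iff_eq (mul_ne_zero h.plus_ne h.minus_ne), hx, exp_add_half, exp_sub_half,
      h.exp_eq, ← factor_prod]
    ring
  obtain ⟨k, hk⟩ := exp_eq_exp_iff_exists_int.1 hexp
  rw [zero_add] at hk
  have him := congrArg Complex.im hk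
  have i1 : ((k : ℂ) * (2 * Real.pi * I)).im = 2 * Real.pi * k := by simp; ring
  have i2 : (3 * log (1 - exp (2 * Real.pi * I * t))).im
      = 3 * arg (1 - exp (2 * Real.pi * I * t)) := by
    simp [log_im]
  rw [sub_im, sub_im, i1, i2, log_im, log_im] at him
  have hσ := abs_lt.1 h.abs_sigma_lt
  have h1 := h.half_le
  have h2 := h.lt_one
  have hP := h.arg_plus
  have hM := h.arg_minus
  have hA := arg_one_sub_exp_of_half_le h1 h2
  set σ := θ.re / Real.pi
  set α := arg (1 - exp (2 * Real.pi * I * t))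
  set β := arg (1 - exp (2 * Real.pi * I * (t + (1 / 2 + θ / Real.pi))))
  set γ := arg (1 - exp (2 * Real.pi * I * (t - (1 / 2 + θ / Real.pi))))
  -- The lower bound `π/3` excludes `k = 0`: at most one of the other two arguments is positive, and
  -- that one is less than `π`.
  have hk1 : k = 1 := by
    have hlt : (k : ℝ) < 2 ∧ 0 < (k : ℝ) := by
      rcases le_total (t.re + σ) 1 with ha | ha
      · have hb := hP.1 ha
        rcases le_total (t.re - σ) 1 with hc | hc
        · have hd := hM.1 hc
          constructor <;> nlinarith
        · have hd := hM.2 hc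
          constructor <;> nlinarith
      · have hb := hP.2 ha
        have hd := hM.1 (by linarith)
        constructor <;> nlinarith
    have a1 : k < 2 := by exact_mod_cast hlt.1
    have a2 : 0 < k := by exact_mod_cast hlt.2
    omega
  rw [hk, hk1]
  simp

end OnCurve

/-! ### The branch `t(θ)` near 0 and on the real segment `[0, π/2)`. -/

theorem pi_div_three_le_arg {z : ℂ} (him : 0 < z.im) (h : 2 * z.re ≤ z.im) :
    Real.pi / 3 ≤ arg z := by
  have hz : z ≠ 0 := by
    rintro rfl
    simp at him
  have e := Real.arccos_cos (x := Real.pi / 3) (by positivity) (by linarith [Real.pi_pos])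
  rw [Real.cos_pi_div_three] at e
  rw [arg_of_im_nonneg_of_ne_zero him.le hz, ← e]
  apply Real.arccos_le_arccos
  rw [div_le_iff₀ (norm_pos_iff.2 hz)]
  have := im_le_norm z
  linarith

theorem arg_le_neg_pi_div_four {z : ℂ} (hre : 0 < z.re) (h : z.re + z.im ≤ 0) :
    arg z ≤ -(Real.pi / 4) := by
  by_contra hcon
  push Not at hcon
  have h1 : |arg z| < Real.pi / 2 := abs_arg_lt_pi_div_two_iff.2 (Or.inl hre)
  have h2 := Real.sin_pos_of_pos_of_lt_pi (x := arg z + Real.pi / 4) (by linarith)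
    (by linarith [(abs_lt.1 h1).2])
  rw [Real.sin_add, Real.cos_pi_div_four, Real.sin_pi_div_four] at h2
  have h3 := norm_mul_sin_arg z
  have h4 := norm_mul_cos_arg z
  have h5 : 0 < ‖z‖ := norm_pos_iff.2 (by rintro rfl; simp at hre)
  have h6 : 0 < Real.sqrt 2 := by positivity
  have h7 : ‖z‖ * (Real.sin (arg z) + Real.cos (arg z)) ≤ 0 := by linarith
  have h8 : 0 < Real.sin (arg z) + Real.cos (arg z) := by
    by_contra h9
    nlinarith
  nlinarith

/-- The solution `t` of `e^{2πit} = 1 - 2i cos θ` with real part near `5/6`. -/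
noncomputable def curveT (θ : ℂ) : ℂ := 1 + log (1 - 2 * I * cos θ) / (2 * Real.pi * I)

theorem curveT_re (θ : ℂ) : (curveT θ).re = 1 + arg (1 - 2 * I * cos θ) / (2 * Real.pi) := by
  have hpi : (Real.pi : ℂ) ≠ 0 := by exact_mod_cast Real.pi_ne_zero
  have e : curveT θ = 1 + (-I * log (1 - 2 * I * cos θ)) / ((2 * Real.pi : ℝ) : ℂ) := by
    rw [curveT]
    push_cast
    field_simp
    linear_combination log (1 - 2 * I * cos θ) * I_sq
  rw [e, add_re, div_ofReal_re]
  simp [log_im]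

theorem exp_curveT {θ : ℂ} (h : 1 - 2 * I * cos θ ≠ 0) :
    exp (2 * Real.pi * I * curveT θ) = 1 - 2 * I * cos θ := by
  have hpi : (Real.pi : ℂ) ≠ 0 := by exact_mod_cast Real.pi_ne_zero
  rw [curveT, mul_add, mul_div_cancel₀ _ (by simp [hpi]), mul_one, exp_add, exp_two_pi_mul_I,
    one_mul, exp_log h]

theorem one_sub_two_I_cos_re (θ : ℂ) : (1 - 2 * I * cos θ).re = 1 + 2 * (cos θ).im := by
  simp

theorem one_sub_two_I_cos_im (θ : ℂ) : (1 - 2 * I * cos θ).im = -(2 * (cos θ).re) := by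
  simp

theorem cos_near_one {θ : ℂ} (h : ‖θ‖ ≤ 0.3) :
    0.95 ≤ (cos θ).re ∧ |(cos θ).im| ≤ 0.05 := by
  have h1 := norm_cos_sub_one_le h
  have h2 := abs_re_le_norm (cos θ - 1)
  have h3 := abs_im_le_norm (cos θ - 1)
  simp only [sub_re, one_re, sub_im, one_im, sub_zero] at h2 h3
  have h4 := (abs_le.1 (h2.trans h1)).1
  constructor <;> linarith

theorem hasDerivAt_curveT {θ : ℂ} (h : 0 < (1 - 2 * I * cos θ).re) :
    ∃ d : ℂ, HasDerivAt curveT d θ :=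
  ⟨_, ((((hasDerivAt_cos θ).const_mul (2 * I)).const_sub 1).clog
    (mem_slitPlane_iff.2 (Or.inl h))).div_const (2 * Real.pi * I) |>.const_add 1⟩

theorem curveT_re_bounds {θ : ℂ} (h : ‖θ‖ ≤ 0.3) :
    3 / 4 ≤ (curveT θ).re ∧ (curveT θ).re ≤ 7 / 8 := by
  obtain ⟨hc1, hc2⟩ := cos_near_one h
  have hc3 := abs_le.1 hc2
  have hpi := Real.pi_pos
  have hre := one_sub_two_I_cos_re θ
  have him := one_sub_two_I_cos_im θ
  have h1 : arg (1 - 2 * I * cos θ) ≤ -(Real.pi / 4) :=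
    arg_le_neg_pi_div_four (by linarith) (by linarith)
  have h2 : |arg (1 - 2 * I * cos θ)| < Real.pi / 2 :=
    abs_arg_lt_pi_div_two_iff.2 (Or.inl (by linarith))
  have h3 := (abs_lt.1 h2).1
  rw [curveT_re]
  constructor
  · have : -1 / 4 ≤ arg (1 - 2 * I * cos θ) / (2 * Real.pi) := by
      rw [le_div_iff₀ (by positivity)]
      linarith
    linarith
  · have : arg (1 - 2 * I * cos θ) / (2 * Real.pi) ≤ -1 / 8 := by
      rw [div_le_iff₀ (by positivity)]
      linarith
    linarith

theorem abs_re_div_pi_le {θ : ℂ} (h : ‖θ‖ ≤ 0.3) : |θ.re / Real.pi| ≤ 0.1 := by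
  have hpi := Real.pi_gt_three
  rw [abs_div, abs_of_pos Real.pi_pos, div_le_iff₀ Real.pi_pos]
  have := abs_re_le_norm θ
  linarith

theorem onCurve_of_norm_le {θ : ℂ} (h : ‖θ‖ ≤ 0.3) : OnCurve (curveT θ) θ := by
  obtain ⟨hc1, hc2⟩ := cos_near_one h
  have hc3 := abs_le.1 hc2
  have hre := one_sub_two_I_cos_re θ
  obtain ⟨h1, h2⟩ := curveT_re_bounds h
  have hσ := abs_le.1 (abs_re_div_pi_le h)
  refine ⟨exp_curveT ?_, by linarith, by linarith, abs_re_lt_of_norm_le h, by linarith,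
    by linarith⟩
  intro h0
  rw [h0, zero_re] at hre
  linarith

theorem onCurve_ofReal {θ : ℝ} (h0 : 0 ≤ θ) (h1 : θ < Real.pi / 2) :
    OnCurve (curveT θ) θ := by
  have hpi := Real.pi_pos
  have hre : (1 - 2 * I * cos (θ : ℂ)).re = 1 := by
    rw [one_sub_two_I_cos_re, ← ofReal_cos, ofReal_im]; ring
  have him : (1 - 2 * I * cos (θ : ℂ)).im = -(2 * Real.cos θ) := by
    rw [one_sub_two_I_cos_im, ← ofReal_cos, ofReal_re]
  have hc : 0 < Real.cos θ := Real.cos_pos_of_mem_Ioo ⟨by linarith, h1⟩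
  have hs0 : 0 ≤ Real.sin θ := Real.sin_nonneg_of_nonneg_of_le_pi h0 (by linarith)
  have hs1 : Real.sin θ < 1 := by nlinarith [Real.sin_sq_add_cos_sq θ, Real.sin_le_one θ]
  have hz : 1 - 2 * I * cos (θ : ℂ) ≠ 0 := by
    intro h
    rw [h, zero_re] at hre
    linarith
  have hb := abs_lt.1 (abs_arg_lt_pi_div_two_iff.2 (Or.inl (hre ▸ one_pos)) :
    |arg (1 - 2 * I * cos (θ : ℂ))| < Real.pi / 2)
  have hneg : arg (1 - 2 * I * cos (θ : ℂ)) < 0 := by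
    rw [arg_neg_iff, him]; linarith
  -- This is the condition `t - θ/π > 1/2`. It comes from the sign of `2 cos θ (1 - sin θ)(1 + 2 sin
  -- θ)`, which is `|w| sin(arg w - 2θ + π)` for `w = 1 - 2i cos θ`.
  have hgt : 2 * θ - Real.pi < arg (1 - 2 * I * cos (θ : ℂ)) := by
    by_contra hcon
    push Not at hcon
    have h3 : Real.sin (arg (1 - 2 * I * cos (θ : ℂ)) - (2 * θ - Real.pi)) ≤ 0 :=
      Real.sin_nonpos_of_nonpos_of_neg_pi_le (by linarith) (by linarith [hb.1])
    rw [show arg (1 - 2 * I * cos (θ : ℂ)) - (2 * θ - Real.pi)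
      = arg (1 - 2 * I * cos (θ : ℂ)) - 2 * θ + Real.pi by ring, Real.sin_add_pi,
      Real.sin_sub] at h3
    have h4 := norm_mul_sin_arg (1 - 2 * I * cos (θ : ℂ))
    have h6 := norm_mul_cos_arg (1 - 2 * I * cos (θ : ℂ))
    have h5 : 0 < ‖1 - 2 * I * cos (θ : ℂ)‖ := norm_pos_iff.2 hz
    rw [him] at h4
    rw [hre] at h6
    have h7 : ‖1 - 2 * I * cos (θ : ℂ)‖ * (Real.sin (arg (1 - 2 * I * cos (θ : ℂ)))
        * Real.cos (2 * θ) - Real.cos (arg (1 - 2 * I * cos (θ : ℂ))) * Real.sin (2 * θ))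
        = -(2 * Real.cos θ * ((1 - Real.sin θ) * (1 + 2 * Real.sin θ))) := by
      have e1 : Real.cos (2 * θ) = 1 - 2 * Real.sin θ ^ 2 := by
        rw [Real.cos_two_mul, Real.cos_sq']; ring
      rw [e1, Real.sin_two_mul]
      linear_combination (1 - 2 * Real.sin θ ^ 2) * h4 - 2 * Real.sin θ * Real.cos θ * h6
    have h8 : 0 < 2 * Real.cos θ * ((1 - Real.sin θ) * (1 + 2 * Real.sin θ)) := by
      have : 0 < 1 - Real.sin θ := by linarith
      positivity
    nlinarith
  have e : Real.pi * (arg (1 - 2 * I * cos (θ : ℂ)) / (2 * Real.pi))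
      = arg (1 - 2 * I * cos (θ : ℂ)) / 2 := by field_simp
  have e2 : Real.pi * (θ / Real.pi) = θ := by field_simp
  refine ⟨exp_curveT hz, ?_, ?_, ?_, ?_, ?_⟩
  · rw [curveT_re]; nlinarith
  · rw [curveT_re]; nlinarith
  · rw [ofReal_re, abs_of_nonneg h0]; exact h1
  · rw [curveT_re, ofReal_re]; nlinarith
  · rw [curveT_re, ofReal_re]; nlinarith

theorem pi_div_three_le_arg_curve {t θ : ℂ} (h : OnCurve t θ)
    (hc : -(2 * (cos θ).im) ≤ (cos θ).re) :
    Real.pi / 3 ≤ arg (1 - exp (2 * Real.pi * I * t)) := by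
  have hp := cos_re_pos h.abs_re_lt
  have e : 1 - exp (2 * Real.pi * I * t) = 2 * I * cos θ := by rw [h.exp_eq]; ring
  rw [e]
  have hre : (2 * I * cos θ).re = -(2 * (cos θ).im) := by simp
  have him : (2 * I * cos θ).im = 2 * (cos θ).re := by simp
  apply pi_div_three_le_arg <;> linarith

/-- Equal exponentials make the two values differ by an integer, and both real parts lie in `[1/2,
1)`. -/
theorem OnCurve.t_unique {t t' θ : ℂ} (h : OnCurve t θ) (h' : OnCurve t' θ) : t = t' := by
  have hpi : (2 * Real.pi * I : ℂ) ≠ 0 := by simp [Real.pi_ne_zero]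
  obtain ⟨k, hk⟩ := exp_eq_exp_iff_exists_int.1 (h.exp_eq.trans h'.exp_eq.symm)
  have hk' : t = t' + k := by
    apply mul_left_cancel₀ hpi
    rw [hk]; ring
  have hre := congrArg Complex.re hk'
  simp only [add_re, intCast_re] at hre
  have h1 := h.half_le
  have h2 := h.lt_one
  have h3 := h'.half_le
  have h4 := h'.lt_one
  have a1 : (k : ℝ) < 1 := by linarith
  have a2 : (-1 : ℝ) < k := by linarith
  have b1 : k < 1 := by exact_mod_cast a1
  have b2 : -1 < k := by exact_mod_cast a2
  have : k = 0 := by omega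
  rw [hk', this]; simp

/-! ### Critical points of `V` and solutions of the fixed-point equation. -/

theorem hasDerivAt_potential_left (p : ℕ) {t s : ℂ} (h1 : 0 < t.re) (h2 : t.re < 1)
    (h3 : 1 < (t + s).re) (h4 : (t + s).re < 2) (h5 : 0 < (t - s).re) (h6 : (t - s).re < 1) :
    HasDerivAt (fun t' : ℂ => potential p t' s)
      (3 * log (1 - exp (2 * Real.pi * I * t)) - log (1 - exp (2 * Real.pi * I * (t + s)))
        - log (1 - exp (2 * Real.pi * I * (t - s))) - 2 * Real.pi * I) t := by
  have hpi : (Real.pi : ℂ) ≠ 0 := by exact_mod_cast Real.pi_ne_zero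
  have d1 := hasDerivAt_dilog_exp ((hasDerivAt_id t).add_const s) 1 (by simpa using h3)
    (by push_cast; simp only [id]; linarith)
  have d2 := hasDerivAt_dilog_exp ((hasDerivAt_id t).sub_const s) 0 (by simpa using h5)
    (by simpa using h6)
  have d3 := hasDerivAt_dilog_exp (hasDerivAt_id t) 0 (by simpa using h1) (by simpa using h2)
  have d0 := (((hasDerivAt_id t).const_mul 2).const_sub
    ((2 * (p : ℂ) + 1) * s ^ 2 - (2 * (p : ℂ) + 3) * s)).const_mul ((Real.pi : ℂ) * I)
  have d := d0.add ((((d1.add d2).sub (d3.const_mul 3)).add_const ((Real.pi : ℂ) ^ 2 / 6)).const_mul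
    (1 / (2 * (Real.pi : ℂ) * I)))
  refine d.congr_deriv ?_
  simp only [id]
  field_simp
  ring

theorem hasDerivAt_potential_right (p : ℕ) {t s : ℂ}
    (h3 : 1 < (t + s).re) (h4 : (t + s).re < 2) (h5 : 0 < (t - s).re) (h6 : (t - s).re < 1) :
    HasDerivAt (fun s' : ℂ => potential p t s')
      (Real.pi * I * ((4 * p + 2) * s - (2 * p + 3))
        - (log (1 - exp (2 * Real.pi * I * (t + s)))
        - log (1 - exp (2 * Real.pi * I * (t - s))))) s := by
  have hpi : (Real.pi : ℂ) ≠ 0 := by exact_mod_cast Real.pi_ne_zero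
  have d1 := hasDerivAt_dilog_exp ((hasDerivAt_id s).const_add t) 1 (by simpa using h3)
    (by push_cast; simp only [id]; linarith)
  have d2 := hasDerivAt_dilog_exp ((hasDerivAt_id s).const_sub t) 0 (by simpa using h5)
    (by simpa using h6)
  have d0 := (((((hasDerivAt_id s).pow 2).const_mul (2 * (p : ℂ) + 1)).sub
    ((hasDerivAt_id s).const_mul (2 * (p : ℂ) + 3))).sub_const (2 * t)).const_mul
      ((Real.pi : ℂ) * I)
  have d := d0.add ((((d1.add d2).sub_const
    (3 * dilog (exp (2 * Real.pi * I * t)))).add_const ((Real.pi : ℂ) ^ 2 / 6)).const_mul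
    (1 / (2 * (Real.pi : ℂ) * I)))
  refine d.congr_deriv ?_
  simp only [id]
  field_simp
  norm_num
  ring

theorem exp_eq_of_log_triple {t θ : ℂ} (h1 : 1 / 2 ≤ t.re) (h2 : t.re < 1)
    (h3 : |θ.re| < Real.pi / 2)
    (hp : 1 - exp (2 * Real.pi * I * (t + (1 / 2 + θ / Real.pi))) ≠ 0)
    (hm : 1 - exp (2 * Real.pi * I * (t - (1 / 2 + θ / Real.pi))) ≠ 0)
    (hlog : 3 * log (1 - exp (2 * Real.pi * I * t))
      - log (1 - exp (2 * Real.pi * I * (t + (1 / 2 + θ / Real.pi))))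
      - log (1 - exp (2 * Real.pi * I * (t - (1 / 2 + θ / Real.pi)))) = 2 * Real.pi * I) :
    exp (2 * Real.pi * I * t) = 1 - 2 * I * cos θ := by
  have hpi := Real.pi_pos
  have hx0 : 1 - exp (2 * Real.pi * I * t) ≠ 0 :=
    slitPlane_ne_zero (one_sub_exp_mem_slitPlane (by linarith) h2)
  have hexp := congrArg exp hlog
  have e3 : exp (3 * log (1 - exp (2 * Real.pi * I * t)))
      = (1 - exp (2 * Real.pi * I * t)) ^ 3 := by
    rw [← exp_log hx0, ← exp_nat_mul, exp_log hx0]; push_cast; rfl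
  rw [exp_sub, exp_sub, exp_log hp, exp_log hm, e3, exp_two_pi_mul_I, div_div,
      div_eq_one_iff_eq (mul_ne_zero hp hm), exp_add_half, exp_sub_half] at hexp
  -- The half-period `1/2 ≤ Re t < 1` puts `x` in the closed lower half-plane, which rules out the
  -- root `1 + 2i cos θ`, since `Re cos θ > 0`.
  have hxim : (exp (2 * Real.pi * I * t)).im ≤ 0 := by
    rw [exp_im]
    have e : (2 * Real.pi * I * t).im = 2 * Real.pi * t.re := by simp
    rw [e]
    apply mul_nonpos_of_nonneg_of_nonpos (Real.exp_pos _).le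
    rw [← Real.sin_sub_two_pi]
    apply Real.sin_nonpos_of_nonpos_of_neg_pi_le <;> nlinarith
  have hx := exp_ne_zero (2 * Real.pi * I * t)
  have hq := exp_ne_zero (I * θ)
  have hc := two_cos_eq θ
  generalize exp (2 * Real.pi * I * t) = x at *
  have hqq : exp (I * θ) * (exp (I * θ))⁻¹ = 1 := mul_inv_cancel₀ hq
  generalize (exp (I * θ))⁻¹ = r at *
  generalize exp (I * θ) = q at *
  have hfac : x * ((x - (1 - 2 * I * cos θ)) * (x - (1 + 2 * I * cos θ))) = 0 := by
    have hsq : (2 * cos θ) ^ 2 = q ^ 2 + 2 + r ^ 2 := by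
      rw [hc]; linear_combination 2 * hqq
    have hqq2 : q ^ 2 * r ^ 2 = 1 := by rw [← mul_pow, hqq, one_pow]
    linear_combination -hexp + x * hsq - 4 * x * (cos θ) ^ 2 * I_sq - x ^ 2 * hqq2
  rcases mul_eq_zero.1 ((mul_eq_zero.1 hfac).resolve_left hx) with h | h
  · exact sub_eq_zero.1 h
  · exfalso
    rw [sub_eq_zero] at h
    have h4 := cos_re_pos h3
    rw [h] at hxim
    simp at hxim
    linarith

theorem IsCriticalPoint.onCurve {p : ℕ} {t s : ℂ} (h : IsCriticalPoint p t s) :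
    OnCurve t (Real.pi * (s - 1 / 2)) ∧
      ((4 * p - 1 : ℝ) : ℂ) * (Real.pi * (s - 1 / 2))
        = 2 * Real.pi - I * invGd (Real.pi * (s - 1 / 2)) ∧
      |(Real.pi * (s - 1 / 2) : ℂ).re| ≤ 0.3 * Real.pi := by
  obtain ⟨⟨a1, a2, a3, a4, a5, a6, a7, a8⟩, ht, hs⟩ := h
  simp only at a1 a2 a3 a4 a5 a6 a7 a8
  have hpi := Real.pi_pos
  have hpi0 : (Real.pi : ℂ) ≠ 0 := by exact_mod_cast Real.pi_ne_zero
  have p1 : 1 < (t + s).re := by rw [add_re]; linarith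
  have p2 : (t + s).re < 2 := by rw [add_re]; linarith
  have m1 : 0 < (t - s).re := by rw [sub_re]; linarith
  have m2 : (t - s).re < 1 := by rw [sub_re]; linarith
  have e1 := ht.unique (hasDerivAt_potential_left p (by linarith) (by linarith) p1 p2 m1 m2)
  have e2 := hs.unique (hasDerivAt_potential_right p p1 p2 m1 m2)
  set θ : ℂ := Real.pi * (s - 1 / 2) with hθ
  have hsθ : s = 1 / 2 + θ / Real.pi := by rw [hθ]; field_simp; ring
  have hre : θ.re = Real.pi * (s.re - 1 / 2) := by rw [hθ, re_ofReal_mul]; simp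
  have hθb : |θ.re| ≤ 0.3 * Real.pi := by
    rw [hre, abs_le]; constructor <;> nlinarith
  have hθlt : |θ.re| < Real.pi / 2 := by linarith
  have hσ : θ.re / Real.pi = s.re - 1 / 2 := by rw [hre]; field_simp
  have hp : 1 - exp (2 * Real.pi * I * (t + s)) ≠ 0 := by
    have := one_sub_exp_mem_slitPlane (z := t + s - 1) (by simp at p1 ⊢; linarith)
      (by simp at p2 ⊢; linarith)
    rw [OnCurve.exp_shift] at this
    exact slitPlane_ne_zero this
  have hm : 1 - exp (2 * Real.pi * I * (t - s)) ≠ 0 :=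
    slitPlane_ne_zero (one_sub_exp_mem_slitPlane m1 m2)
  have hc : OnCurve t θ := by
    refine ⟨?_, by linarith, by linarith, hθlt, by linarith, by linarith⟩
    apply exp_eq_of_log_triple (by linarith) (by linarith) hθlt
    · rwa [← hsθ]
    · rwa [← hsθ]
    · rw [← hsθ]; linear_combination -e1
  refine ⟨hc, ?_, hθb⟩
  have hl := hc.log_sub_log
  rw [← hsθ] at hl
  rw [hl, hsθ] at e2
  -- The `3iθ` from the logarithms lowers the coefficient `4p + 2` to `4p - 1`.
  have e3 : 0 = I * ((4 * p + 2) * θ) - 2 * Real.pi * I - (3 * I * θ + invGd θ) := by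
    rw [e2]; field_simp; ring
  push_cast
  linear_combination I * e3 + ((4 * p - 1) * θ - 2 * Real.pi) * I_sq

theorem isCriticalPoint_of_fixedPoint {p : ℕ} {θ : ℂ} (h : ‖θ‖ ≤ 0.3)
    (hfix : ((4 * p - 1 : ℝ) : ℂ) * θ = 2 * Real.pi - I * invGd θ) :
    IsCriticalPoint p (curveT θ) (1 / 2 + θ / Real.pi) := by
  have hpi0 : (Real.pi : ℂ) ≠ 0 := by exact_mod_cast Real.pi_ne_zero
  have hc := onCurve_of_norm_le h
  obtain ⟨t1, t2⟩ := curveT_re_bounds h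
  have hσ := abs_le.1 (abs_re_div_pi_le h)
  have hsre : (1 / 2 + θ / Real.pi : ℂ).re = 1 / 2 + θ.re / Real.pi := by
    rw [add_re, div_ofReal_re]; norm_num
  have hcos := cos_near_one h
  have hcos2 := abs_le.1 hcos.2
  have ht := hc.log_triple (pi_div_three_le_arg_curve hc (by linarith))
  have hl := hc.log_sub_log
  have p1 : 1 < (curveT θ + (1 / 2 + θ / Real.pi)).re := by rw [add_re, hsre]; linarith
  have p2 : (curveT θ + (1 / 2 + θ / Real.pi)).re < 2 := by rw [add_re, hsre]; linarith
  have m1 : 0 < (curveT θ - (1 / 2 + θ / Real.pi)).re := by rw [sub_re, hsre]; linarith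
  have m2 : (curveT θ - (1 / 2 + θ / Real.pi)).re < 1 := by rw [sub_re, hsre]; linarith
  refine ⟨?_, ?_, ?_⟩
  · simp only [regionD₀, Set.mem_ofPred_eq, hsre]
    refine ⟨?_, ?_, ?_, ?_, ?_, ?_, ?_, ?_⟩ <;> linarith
  · refine (hasDerivAt_potential_left p (by linarith) (by linarith) p1 p2 m1 m2).congr_deriv ?_
    rw [ht]; ring
  · refine (hasDerivAt_potential_right p p1 p2 m1 m2).congr_deriv ?_
    rw [hl]
    push_cast at hfix
    field_simp
    linear_combination 2 * I * hfix - 2 * invGd θ * I_sq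

/-! ### The critical value. -/

/-- The part of `2π V(p, t, s)` that does not depend on `p`, along the curve. -/
noncomputable def curveG (θ : ℂ) : ℂ :=
  -I * (dilog (exp (2 * Real.pi * I * (curveT θ + (1 / 2 + θ / Real.pi))))
      + dilog (exp (2 * Real.pi * I * (curveT θ - (1 / 2 + θ / Real.pi))))
      - 3 * dilog (exp (2 * Real.pi * I * curveT θ)) + (Real.pi : ℂ) ^ 2 / 6)
    - 4 * (Real.pi : ℂ) ^ 2 * I * curveT θ

theorem two_pi_mul_potential (p : ℕ) (θ : ℂ) :
    2 * Real.pi * potential p (curveT θ) (1 / 2 + θ / Real.pi)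
      = curveG θ + I * (2 * (2 * p + 1) * θ ^ 2 - 4 * Real.pi * θ)
        - ((Real.pi ^ 2 * (p + 5 / 2) : ℝ) : ℂ) * I := by
  have hpi0 : (Real.pi : ℂ) ≠ 0 := by exact_mod_cast Real.pi_ne_zero
  rw [potential, curveG]
  have e : (2 * Real.pi : ℂ) * (1 / (2 * Real.pi * I)) = -I := by
    field_simp
    rw [I_sq, neg_neg]
  rw [mul_add, ← mul_assoc (2 * Real.pi : ℂ) (1 / (2 * Real.pi * I)), e]
  push_cast
  field_simp
  ring

/-- The derivative of `curveT` is multiplied by the left side of the equation `∂V/∂t = 0`, which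
holds all along the curve, so it cancels and its value is never needed. Only the dependence through
`s` remains. -/
theorem hasDerivAt_curveG {θ : ℂ} (h : OnCurve (curveT θ) θ)
    (hre : 0 < (1 - 2 * I * cos θ).re) (hc : -(2 * (cos θ).im) ≤ (cos θ).re) :
    HasDerivAt curveG (-(2 * (3 * I * θ + invGd θ))) θ := by
  have hpi0 : (Real.pi : ℂ) ≠ 0 := by exact_mod_cast Real.pi_ne_zero
  obtain ⟨d, hd⟩ := hasDerivAt_curveT hre
  have hσ := abs_lt.1 h.abs_sigma_lt
  have hs : HasDerivAt (fun θ : ℂ => 1 / 2 + θ / (Real.pi : ℂ)) (1 / Real.pi) θ :=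
    ((hasDerivAt_id θ).div_const _).const_add _
  have rp := OnCurve.re_plus (curveT θ) θ
  have rm := OnCurve.re_minus (curveT θ) θ
  rw [sub_re, one_re] at rp
  have b1 := h.half_le
  have b2 := h.lt_one
  have b3 := h.lt_add
  have b4 := h.lt_sub
  have d1 := hasDerivAt_dilog_exp (hd.add hs) 1
    (by simp only [Pi.add_apply]; push_cast; linarith)
    (by simp only [Pi.add_apply]; push_cast; linarith)
  have d2 := hasDerivAt_dilog_exp (hd.sub hs) 0
    (by simp only [Pi.sub_apply]; push_cast; linarith)
    (by simp only [Pi.sub_apply]; push_cast; linarith)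
  have d3 := hasDerivAt_dilog_exp hd 0 (by push_cast; linarith) (by push_cast; linarith)
  have D := ((((d1.add d2).sub (d3.const_mul 3)).add_const ((Real.pi : ℂ) ^ 2 / 6)).const_mul
    (-I)).sub (hd.const_mul (4 * (Real.pi : ℂ) ^ 2 * I))
  refine D.congr_deriv ?_
  have ht := h.log_triple (pi_div_three_le_arg_curve h hc)
  have hl := h.log_sub_log
  rw [← hl]
  simp only [Pi.add_apply, Pi.sub_apply]
  generalize log (1 - exp (2 * Real.pi * I * (curveT θ + (1 / 2 + θ / Real.pi)))) = A at ht ⊢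
  generalize log (1 - exp (2 * Real.pi * I * (curveT θ - (1 / 2 + θ / Real.pi)))) = B at ht ⊢
  generalize log (1 - exp (2 * Real.pi * I * curveT θ)) = C at ht ⊢
  field_simp
  linear_combination 2 * Real.pi * d * ht
    + 2 * (Real.pi * d * (A + B - 3 * C) + (A - B)) * I_sq

/-- The corrected function has derivative `z(1/cos z - 1) - (gd⁻¹(z) - z)`, and each term is at most
`0.06 |z|`. The mean value inequality on the disc of radius `‖θ‖` supplies the second factor `‖θ‖`.
-/
theorem norm_curveG_sub_le {θ : ℂ} (h : ‖θ‖ ≤ 0.3) :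
    ‖curveG θ - curveG 0 + 3 * I * θ ^ 2 + θ * invGd θ‖ ≤ 0.12 * ‖θ‖ ^ 2 := by
  have := Convex.norm_image_sub_le_of_norm_hasDerivWithin_le
    (s := Metric.closedBall (0 : ℂ) ‖θ‖)
    (f := fun z => curveG z + 3 * I * z ^ 2 + z * invGd z)
    (f' := fun z => z * (1 / cos z - 1) - (invGd z - z)) (C := 0.12 * ‖θ‖) (x := 0) (y := θ)
    (fun y hy => ?_) (fun y hy => ?_) (convex_closedBall _ _)
    (by simp) (by simp)
  · rw [sub_zero] at this
    convert this using 1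
    · congr 1
      simp
      ring
    · ring
  · rw [mem_closedBall_zero_iff] at hy
    have hy' := hy.trans h
    have hc := cos_near_one hy'
    have hc2 := abs_le.1 hc.2
    have d1 := hasDerivAt_curveG (onCurve_of_norm_le hy')
      (by rw [one_sub_two_I_cos_re]; linarith) (by linarith)
    have d2 := (hasDerivAt_id y).mul (hasDerivAt_invGd (abs_re_lt_of_norm_le hy'))
    have d3 := ((hasDerivAt_id y).pow 2).const_mul (3 * I)
    refine ((d1.add d3).add d2).hasDerivWithinAt.congr_deriv ?_
    simp
    ring
  · rw [mem_closedBall_zero_iff] at hy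
    have hy' := hy.trans h
    have h1 := norm_sec_sub_one_le hy'
    have h2 := norm_invGd_sub_self_le hy'
    refine (norm_sub_le _ _).trans ?_
    rw [norm_mul]
    nlinarith [norm_nonneg y]

theorem re_potential_ge {p : ℕ} (hp : 6 ≤ p) {θ : ℂ} (h : ‖θ‖ ≤ 0.3)
    (hfix : ((4 * p - 1 : ℝ) : ℂ) * θ = 2 * Real.pi - I * invGd θ) :
    (curveG 0).re - 49 * Real.pi ^ 2 / 64 * (1 / (p : ℝ) ^ 2)
      ≤ 2 * Real.pi * (potential p (curveT θ) (1 / 2 + θ / Real.pi)).re := by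
  have hpi := Real.pi_pos
  have hP : (6 : ℝ) ≤ p := by exact_mod_cast hp
  have hV := two_pi_mul_potential p θ
  set K := curveG θ - curveG 0 + 3 * I * θ ^ 2 + θ * invGd θ with hK
  have hKle : ‖K‖ ≤ 0.12 * ‖θ‖ ^ 2 := norm_curveG_sub_le h
  -- The fixed-point equation times `iθ` eliminates every quadratic term in `θ` and the product `θ
  -- gd⁻¹(θ)`; what is left is linear in `θ` up to the error `K`.
  have hV2 : 2 * Real.pi * potential p (curveT θ) (1 / 2 + θ / Real.pi)
      = curveG 0 + K - 2 * Real.pi * I * θ - ((Real.pi ^ 2 * (p + 5 / 2) : ℝ) : ℂ) * I := by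
    rw [hV, hK]
    push_cast at hfix
    linear_combination I * θ * hfix - θ * invGd θ * I_sq
  have hre := congrArg Complex.re hV2
  have e1 : (2 * Real.pi * potential p (curveT θ) (1 / 2 + θ / Real.pi)).re
      = 2 * Real.pi * (potential p (curveT θ) (1 / 2 + θ / Real.pi)).re := by
    simp
  have e2 : (2 * Real.pi * I * θ).re = -(2 * Real.pi * θ.im) := by simp
  rw [e1, sub_re, sub_re, add_re, e2, re_ofReal_mul, I_re, mul_zero, sub_zero] at hre
  rw [hre]
  have hKre := (abs_le.1 ((abs_re_le_norm K).trans hKle)).1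
  have hL := norm_invGd_le h
  have him := congrArg Complex.im hfix
  have e3 : (2 * Real.pi - I * invGd θ).im = -(invGd θ).re := by simp
  rw [im_ofReal_mul, e3] at him
  have hLre := (abs_le.1 ((abs_re_le_norm (invGd θ)).trans hL)).2
  have hn := congrArg norm hfix
  rw [norm_mul, norm_real, Real.norm_of_nonneg (by linarith)] at hn
  have hn2 := norm_sub_le (2 * Real.pi : ℂ) (I * invGd θ)
  have e4 : ‖(2 * Real.pi : ℂ)‖ = 2 * Real.pi := by simp [abs_of_pos hpi]
  rw [← hn, e4, norm_mul I, norm_I, one_mul] at hn2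
  have hn0 := norm_nonneg θ
  set n := ‖θ‖
  set P : ℝ := (p : ℝ)
  -- For `p ≥ 6`, `4p - 1 - 1.06 ≥ 3.6p` and `4p - 1 ≥ 3.8p`. The loss obtained below is at most
  -- `(0.4 + 0.12 · 0.36) π²/p²`, well within `49π²/(64p²)`.
  have h1 : 3.6 * (P * n) ≤ 2 * Real.pi := by nlinarith
  have h2 : 3.8 * P * θ.im ≥ -(1.06 * n) := by
    rcases le_total 0 θ.im with hi | hi
    · have : 0 ≤ 3.8 * P * θ.im := by positivity
      linarith
    · nlinarith
  have hPpos : 0 < P := by linarith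
  have h3 : P * n ≤ 0.6 * Real.pi := by linarith
  have h4 : -(0.2 * Real.pi) ≤ P * (P * θ.im) := by
    nlinarith
  have h5 : (P * n) ^ 2 ≤ 0.36 * Real.pi ^ 2 := by
    have : 0 ≤ P * n := by positivity
    nlinarith
  have h6 : -(49 * Real.pi ^ 2 / 64) ≤ P ^ 2 * (2 * Real.pi * θ.im - 0.12 * n ^ 2) := by
    nlinarith
  have h7 : -(49 * Real.pi ^ 2 / 64) * (1 / P ^ 2) ≤ 2 * Real.pi * θ.im - 0.12 * n ^ 2 := by
    rw [mul_one_div, div_le_iff₀ (by positivity)]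
    linarith
  linarith

/-! ### `Re G(0)` as a log-trigonometric integral. -/

theorem hasDerivAt_re_curveG {θ : ℝ} (h0 : 0 ≤ θ) (h1 : θ < Real.pi / 2) :
    HasDerivAt (fun θ : ℝ => (curveG θ).re)
      (-(2 * (Real.log (1 + Real.sin θ) - Real.log (Real.cos θ)))) θ := by
  have hc : 0 < Real.cos θ := Real.cos_pos_of_mem_Ioo ⟨by linarith [Real.pi_pos], h1⟩
  have hs0 : 0 ≤ Real.sin θ :=
    Real.sin_nonneg_of_nonneg_of_le_pi h0 (by linarith [Real.pi_pos])
  have h := (hasDerivAt_curveG (onCurve_ofReal h0 h1)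
    (by rw [one_sub_two_I_cos_re, ← ofReal_cos, ofReal_im]; norm_num)
    (by rw [← ofReal_cos, ofReal_im, ofReal_re]; linarith)).real_of_complex
  refine h.congr_deriv ?_
  rw [invGd, ← ofReal_cos, ← ofReal_sin, ← ofReal_one, ← ofReal_add, ← ofReal_div,
    ← ofReal_log (by positivity), Real.log_div (by linarith) hc.ne']
  simp

/-- At `θ = π/2` both `t` and `s` become 1, so all three exponentials tend to 1. Only the imaginary
parts of the dilogarithms and of `t` enter the real part of `G`, and these vanish in the limit. -/
theorem tendsto_re_curveG :
    Tendsto (fun θ : ℝ => (curveG θ).re) (𝓝[<] (Real.pi / 2)) (𝓝 0) := by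
  have hpi0 : (Real.pi : ℂ) ≠ 0 := by exact_mod_cast Real.pi_ne_zero
  have hcos : cos ((Real.pi / 2 : ℝ) : ℂ) = 0 := by
    rw [← ofReal_cos, Real.cos_pi_div_two, ofReal_zero]
  have hT : Tendsto (fun θ : ℝ => curveT θ) (𝓝[<] (Real.pi / 2)) (𝓝 1) := by
    obtain ⟨d, hd⟩ := hasDerivAt_curveT (θ := ((Real.pi / 2 : ℝ) : ℂ)) (by rw [hcos]; simp)
    have h1 : curveT ((Real.pi / 2 : ℝ) : ℂ) = 1 := by rw [curveT, hcos]; simp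
    have h2 := hd.continuousAt.tendsto
    rw [h1] at h2
    exact (h2.comp (continuous_ofReal.tendsto _)).mono_left nhdsWithin_le_nhds
  have hS : Tendsto (fun θ : ℝ => (1 / 2 + (θ : ℂ) / Real.pi)) (𝓝[<] (Real.pi / 2)) (𝓝 1) := by
    have hc : Continuous fun θ : ℝ => (1 / 2 + (θ : ℂ) / Real.pi) := by fun_prop
    have h2 := hc.tendsto (Real.pi / 2)
    have e : (1 / 2 + ((Real.pi / 2 : ℝ) : ℂ) / Real.pi) = 1 := by
      push_cast
      field_simp
      norm_num
    rw [e] at h2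
    exact h2.mono_left nhdsWithin_le_nhds
  have hev : ∀ᶠ θ : ℝ in 𝓝[<] (Real.pi / 2), OnCurve (curveT θ) θ := by
    have : Set.Ioo 0 (Real.pi / 2) ∈ 𝓝[<] (Real.pi / 2) :=
      Ioo_mem_nhdsLT (by linarith [Real.pi_pos])
    filter_upwards [this] with θ hθ using onCurve_ofReal hθ.1.le hθ.2
  have hexp : ∀ {f : ℝ → ℂ} (n : ℤ), Tendsto f (𝓝[<] (Real.pi / 2)) (𝓝 n) →
      Tendsto (fun θ => exp (2 * Real.pi * I * f θ)) (𝓝[<] (Real.pi / 2)) (𝓝 1) := by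
    intro f n hf
    have h := (continuous_exp.tendsto _).comp (hf.const_mul (2 * Real.pi * I : ℂ))
    have e : exp (2 * Real.pi * I * n) = 1 := by
      rw [mul_comm]; exact exp_int_mul_two_pi_mul_I n
    rw [e] at h
    exact h
  have d1 := tendsto_dilog_im (hexp 2 (by
      have := hT.add hS
      norm_num at this ⊢
      exact this)) (by
    filter_upwards [hev] with θ hθ
    have hσ := abs_lt.1 hθ.abs_sigma_lt
    rw [← OnCurve.exp_shift]
    apply one_sub_exp_mem_slitPlane <;> rw [OnCurve.re_plus]
    · linarith [hθ.lt_add]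
    · linarith [hθ.lt_one])
  have d2 := tendsto_dilog_im (hexp (f := fun θ : ℝ => curveT θ - (1 / 2 + (θ : ℂ) / Real.pi)) 0
    (by simpa using hT.sub hS)) (by
    filter_upwards [hev] with θ hθ
    have hσ := abs_lt.1 hθ.abs_sigma_lt
    apply one_sub_exp_mem_slitPlane <;> rw [OnCurve.re_minus]
    · linarith [hθ.lt_sub]
    · linarith [hθ.lt_one])
  have d3 := tendsto_dilog_im (hexp 1 (by simpa using hT)) (by
    filter_upwards [hev] with θ hθ
    exact one_sub_exp_mem_slitPlane (by linarith [hθ.half_le]) hθ.lt_one)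
  have d4 := ((continuous_im.tendsto _).comp hT).const_mul (4 * Real.pi ^ 2)
  have d := ((d1.add d2).sub (d3.const_mul 3)).add d4
  simp only [one_im, mul_zero, add_zero, sub_zero] at d
  refine d.congr fun θ => ?_
  rw [curveG]
  have e1 : (4 * (Real.pi : ℂ) ^ 2 * I * curveT θ).re = -(4 * Real.pi ^ 2 * (curveT θ).im) := by
    rw [show 4 * (Real.pi : ℂ) ^ 2 * I * curveT θ
      = ((4 * Real.pi ^ 2 : ℝ) : ℂ) * (I * curveT θ) by push_cast; ring, re_ofReal_mul]
    simp
  have e2 : ((Real.pi : ℂ) ^ 2 / 6).im = 0 := by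
    rw [show (Real.pi : ℂ) ^ 2 / 6 = ((Real.pi ^ 2 / 6 : ℝ) : ℂ) by push_cast; rfl, ofReal_im]
  rw [sub_re, e1]
  simp [e2]

theorem intervalIntegrable_log_one_add_sin {a b : ℝ} (ha : 0 ≤ a) (hab : a ≤ b)
    (hb : b ≤ Real.pi) :
    IntervalIntegrable (fun θ => Real.log (1 + Real.sin θ)) volume a b := by
  apply ContinuousOn.intervalIntegrable
  apply ContinuousOn.log (by fun_prop)
  intro θ hθ
  rw [Set.uIcc_of_le hab] at hθ
  have := Real.sin_nonneg_of_nonneg_of_le_pi (ha.trans hθ.1) (hθ.2.trans hb)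
  linarith

theorem re_curveG_zero : (curveG 0).re
    = 2 * ∫ θ in (0 : ℝ)..(Real.pi / 2), (Real.log (1 + Real.sin θ) - Real.log (Real.cos θ)) := by
  have hpi := Real.pi_pos
  have h := intervalIntegral.integral_eq_sub_of_hasDerivAt_of_tendsto (a := 0) (b := Real.pi / 2)
    (f := fun θ : ℝ => (curveG θ).re)
    (f' := fun θ => -(2 * (Real.log (1 + Real.sin θ) - Real.log (Real.cos θ))))
    (by positivity) (fun θ hθ => hasDerivAt_re_curveG hθ.1.le hθ.2)
    (((intervalIntegrable_log_one_add_sin le_rfl (by positivity) (by linarith)).sub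
      intervalIntegrable_log_cos).const_mul 2).neg
    ((hasDerivAt_re_curveG le_rfl (by positivity)).continuousAt.tendsto.mono_left
      nhdsWithin_le_nhds) tendsto_re_curveG
  rw [intervalIntegral.integral_neg, intervalIntegral.integral_const_mul, ofReal_zero] at h
  linarith

/-! ### The volume of the regular ideal octahedron. -/

theorem lintegral_inv_cube {c : ℝ} (hc : 0 < c) :
    ∫⁻ z in Set.Ici c, ENNReal.ofReal (1 / z ^ 3) = ENNReal.ofReal (1 / (2 * c ^ 2)) := by
  have hcongr : Set.EqOn (fun z : ℝ => z ^ (-3 : ℝ)) (fun z => 1 / z ^ 3) (Set.Ioi c) := by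
    intro z hz
    have hz0 : 0 < z := hc.trans hz
    simp only
    rw [Real.rpow_neg hz0.le, one_div]
    norm_cast
  have hi : IntegrableOn (fun z : ℝ => 1 / z ^ 3) (Set.Ioi c) :=
    (integrableOn_Ioi_rpow_of_lt (by norm_num : (-3 : ℝ) < -1) hc).congr_fun hcongr
      measurableSet_Ioi
  have hv := integral_Ioi_rpow_of_lt (by norm_num : (-3 : ℝ) < -1) hc
  rw [setIntegral_congr_fun measurableSet_Ioi hcongr] at hv
  rw [setLIntegral_congr Ioi_ae_eq_Ici.symm, ← ofReal_integral_eq_lintegral_ofReal hi, hv]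
  · congr 1
    rw [show (-3 : ℝ) + 1 = -2 by norm_num, Real.rpow_neg hc.le, Real.rpow_two]
    field_simp
  · filter_upwards [ae_restrict_mem measurableSet_Ioi] with z hz
    have hz0 : 0 < z := hc.trans hz
    simp only [Pi.zero_apply]
    positivity

theorem measurableSet_regularIdealOctahedron : MeasurableSet regularIdealOctahedron := by
  have h1 : MeasurableSet {q : ℝ × ℝ × ℝ | 0 < q.2.2} :=
    measurableSet_lt (by fun_prop) (by fun_prop)
  have h2 : MeasurableSet {q : ℝ × ℝ × ℝ | |q.1| + |q.2.1| ≤ 1} :=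
    (isClosed_le (by fun_prop) (by fun_prop)).measurableSet
  have h3 : MeasurableSet {q : ℝ × ℝ × ℝ |
      1 / 2 ≤ (|q.1| - 1 / 2) ^ 2 + (|q.2.1| - 1 / 2) ^ 2 + q.2.2 ^ 2} :=
    (isClosed_le (by fun_prop) (by fun_prop)).measurableSet
  exact h1.inter (h2.inter h3)

/-- The density of the octahedron with respect to Lebesgue measure. -/
noncomputable def octDensity : ℝ × ℝ × ℝ → ENNReal :=
  regularIdealOctahedron.indicator fun q => ENNReal.ofReal (1 / q.2.2 ^ 3)

theorem measurable_octDensity : Measurable octDensity :=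
  Measurable.indicator (by fun_prop) measurableSet_regularIdealOctahedron

theorem v₈_eq_lintegral : v₈ = (∫⁻ q, octDensity q).toReal := by
  rw [v₈, hyperbolicVolume, integral_eq_lintegral_of_nonneg_ae, octDensity,
    lintegral_indicator measurableSet_regularIdealOctahedron]
  · filter_upwards [ae_restrict_mem measurableSet_regularIdealOctahedron] with q hq
    have : 0 < q.2.2 := hq.1
    simp only [Pi.zero_apply]
    positivity
  · apply Measurable.aestronglyMeasurable
    fun_prop

/-- The hyperbolic mass of the octahedron over a point of the boundary plane. -/
noncomputable def octFiber (x : ℝ × ℝ) : ENNReal := ∫⁻ z, octDensity (x.1, x.2, z)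

theorem measurable_octFiber : Measurable octFiber :=
  Measurable.lintegral_prod_right' (f := fun w : (ℝ × ℝ) × ℝ => octDensity (w.1.1, w.1.2, w.2))
    (measurable_octDensity.comp (by fun_prop))

theorem lintegral_octDensity : ∫⁻ q, octDensity q = ∫⁻ x, octFiber x := by
  rw [← (volume_preserving_prodAssoc (α₁ := ℝ) (β₁ := ℝ) (γ₁ := ℝ)).lintegral_comp
    measurable_octDensity]
  exact lintegral_prod (μ := (volume : Measure (ℝ × ℝ))) (ν := (volume : Measure ℝ)) _
    (measurable_octDensity.comp (MeasurableEquiv.measurable _)).aemeasurable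

theorem octFiber_eq_zero {x : ℝ × ℝ} (h : 1 < |x.1| + |x.2|) : octFiber x = 0 := by
  rw [octFiber]
  refine (lintegral_congr fun z => ?_).trans lintegral_zero
  rw [octDensity, Set.indicator_of_notMem]
  rintro ⟨-, h2, -⟩
  simp only at h2
  linarith

/-- The floor over `x` is a hemisphere of squared height `|x₁| + |x₂| - x₁² - x₂²`, and the vertical
integral of `1 / z³` from height `c` is `1 / (2c²)`. -/
theorem octFiber_eq {x : ℝ × ℝ} (h : |x.1| + |x.2| ≤ 1)
    (h0 : 0 < |x.1| + |x.2| - x.1 ^ 2 - x.2 ^ 2) :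
    octFiber x = ENNReal.ofReal (1 / (2 * (|x.1| + |x.2| - x.1 ^ 2 - x.2 ^ 2))) := by
  set c := |x.1| + |x.2| - x.1 ^ 2 - x.2 ^ 2 with hc
  have hs : 0 < Real.sqrt c := Real.sqrt_pos.2 h0
  have h1 := lintegral_inv_cube hs
  rw [Real.sq_sqrt h0.le, ← lintegral_indicator measurableSet_Ici] at h1
  rw [octFiber, ← h1]
  refine lintegral_congr fun z => ?_
  have hiff : ((x.1, x.2, z) : ℝ × ℝ × ℝ) ∈ regularIdealOctahedron ↔ z ∈ Set.Ici (Real.sqrt c) := by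
    simp only [regularIdealOctahedron, Set.mem_ofPred_eq, Set.mem_Ici]
    have e1 := sq_abs x.1
    have e2 := sq_abs x.2
    constructor
    · rintro ⟨hz, -, h3⟩
      rw [Real.sqrt_le_left hz.le]
      nlinarith
    · intro hz
      have hz0 : 0 < z := hs.trans_le hz
      rw [Real.sqrt_le_left hz0.le] at hz
      exact ⟨hz0, h, by nlinarith⟩
  rw [octDensity]
  by_cases hz : z ∈ Set.Ici (Real.sqrt c)
  · rw [Set.indicator_of_mem (hiff.2 hz), Set.indicator_of_mem hz]
  · rw [Set.indicator_of_notMem (fun h => hz (hiff.1 h)), Set.indicator_of_notMem hz]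

theorem sq_abs_cos_add_abs_sin (φ : ℝ) :
    (|Real.cos φ| + |Real.sin φ|) ^ 2 = 1 + |Real.sin (2 * φ)| := by
  rw [Real.sin_two_mul, abs_mul, abs_mul, abs_two]
  have e1 := sq_abs (Real.cos φ)
  have e2 := sq_abs (Real.sin φ)
  linear_combination e1 + e2 + Real.sin_sq_add_cos_sq φ

/-- With `k = |cos φ| + |sin φ|` the squared floor height is `r(k - r)`, so the Jacobian `r` cancels
the singularity at the vertex 0. The ray leaves the square at `r = 1/k`, before `r = k`, because `k
> 1`. -/
theorem octFiber_polar {r φ : ℝ} (hr : 0 < r) (hφ : Real.sin (2 * φ) ≠ 0) :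
    ENNReal.ofReal r * octFiber (r * Real.cos φ, r * Real.sin φ)
      = (Set.Iic (1 / (|Real.cos φ| + |Real.sin φ|))).indicator
        (fun r => ENNReal.ofReal (1 / (2 * (|Real.cos φ| + |Real.sin φ| - r)))) r := by
  have hk := sq_abs_cos_add_abs_sin φ
  have hs : 0 < |Real.sin (2 * φ)| := abs_pos.2 hφ
  set k := |Real.cos φ| + |Real.sin φ| with hkdef
  have hk0 : 0 ≤ k := by positivity
  have hk1 : 1 < k := by nlinarith
  have hsum : |r * Real.cos φ| + |r * Real.sin φ| = r * k := by
    rw [abs_mul, abs_mul, abs_of_pos hr, hkdef]; ring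
  rw [Set.indicator_apply]
  split_ifs with h
  · rw [Set.mem_Iic, le_div_iff₀ (by linarith)] at h
    have hrk : r < k := by nlinarith
    have hd : |r * Real.cos φ| + |r * Real.sin φ| - (r * Real.cos φ) ^ 2 - (r * Real.sin φ) ^ 2
        = r * (k - r) := by
      rw [hsum]
      linear_combination -r ^ 2 * Real.sin_sq_add_cos_sq φ
    have hpos : 0 < r * (k - r) := mul_pos hr (by linarith)
    rw [octFiber_eq (by simp only; rw [hsum]; exact h) (by simp only; rw [hd]; exact hpos)]
    simp only
    rw [hd, ← ENNReal.ofReal_mul hr.le]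
    congr 1
    have : k - r ≠ 0 := by linarith
    field_simp
  · rw [Set.mem_Iic, le_div_iff₀ (by linarith), not_le] at h
    rw [octFiber_eq_zero (by simp only; rw [hsum]; exact h), mul_zero]

theorem integral_inv_sub {k : ℝ} (hk : 1 < k) :
    ∫ r in (0 : ℝ)..(1 / k), 1 / (2 * (k - r))
      = 1 / 2 * (Real.log (k ^ 2) - Real.log (k ^ 2 - 1)) := by
  have hk0 : 0 < k := by linarith
  have hlt : 1 / k < k := by rw [div_lt_iff₀ hk0]; nlinarith
  have hne : ∀ r ∈ Set.uIcc 0 (1 / k), 0 < k - r := fun r hr => by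
    rw [Set.uIcc_of_le (by positivity)] at hr
    linarith [hr.2]
  rw [intervalIntegral.integral_eq_sub_of_hasDerivAt (f := fun r => -(1 / 2 * Real.log (k - r)))]
  · have e : k - 1 / k = (k ^ 2 - 1) / k := by field_simp
    rw [e, Real.log_div (by nlinarith) hk0.ne', Real.log_pow, sub_zero]
    push_cast
    ring
  · intro r hr
    have h := (((hasDerivAt_id r).const_sub k).log (hne r hr).ne').const_mul (1 / 2) |>.neg
    refine h.congr_deriv ?_
    have := (hne r hr).ne'
    simp only [id]
    field_simp
  · apply ContinuousOn.intervalIntegrable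
    refine ContinuousOn.div (by fun_prop) (by fun_prop) fun r hr => ?_
    have := (hne r hr).ne'
    positivity

/-- Here `k² = 1 + |sin 2φ|`, so `k² - 1 = |sin 2φ|`; the absolute value is dropped inside the
second logarithm because `Real.log` is even. -/
theorem lintegral_octFiber_ray {φ : ℝ} (hφ : Real.sin (2 * φ) ≠ 0) :
    ∫⁻ r in Set.Ioi (0 : ℝ), ENNReal.ofReal r * octFiber (r * Real.cos φ, r * Real.sin φ)
      = ENNReal.ofReal
        (1 / 2 * (Real.log (1 + |Real.sin (2 * φ)|) - Real.log (Real.sin (2 * φ)))) := by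
  rw [setLIntegral_congr_fun measurableSet_Ioi (fun r hr => octFiber_polar hr hφ),
    lintegral_indicator measurableSet_Iic, Measure.restrict_restrict measurableSet_Iic,
    Set.inter_comm, Set.Ioi_inter_Iic]
  have hk := sq_abs_cos_add_abs_sin φ
  have hs : 0 < |Real.sin (2 * φ)| := abs_pos.2 hφ
  set k := |Real.cos φ| + |Real.sin φ| with hkdef
  have hk0 : 0 ≤ k := by positivity
  have hk1 : 1 < k := by nlinarith
  have hlt : 1 / k < k := by rw [div_lt_iff₀ (by linarith)]; nlinarith
  have hi : IntegrableOn (fun r => 1 / (2 * (k - r))) (Set.Ioc 0 (1 / k)) := by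
    apply IntegrableOn.mono_set _ Set.Ioc_subset_Icc_self
    apply ContinuousOn.integrableOn_Icc
    refine ContinuousOn.div (by fun_prop) (by fun_prop) fun r hr => ?_
    have : k - r ≠ 0 := by linarith [hr.2]
    positivity
  rw [← ofReal_integral_eq_lintegral_ofReal hi, ← intervalIntegral.integral_of_le (by positivity),
    integral_inv_sub hk1, hk, add_sub_cancel_left, Real.log_abs]
  filter_upwards [ae_restrict_mem measurableSet_Ioc] with r hr
  have : 0 < k - r := by linarith [hr.2]
  simp only [Pi.zero_apply]
  positivity

theorem ae_sin_two_mul_ne_zero : ∀ᵐ φ : ℝ, Real.sin (2 * φ) ≠ 0 := by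
  have hc : Set.Countable {φ : ℝ | Real.sin (2 * φ) = 0} := by
    refine (Set.countable_range fun n : ℤ => n * Real.pi / 2).mono fun φ hφ => ?_
    obtain ⟨n, hn⟩ := Real.sin_eq_zero_iff.1 hφ
    exact ⟨n, by simp only; linarith⟩
  filter_upwards [hc.ae_notMem volume] with φ hφ using hφ

theorem lintegral_octFiber : ∫⁻ x, octFiber x
    = ∫⁻ φ in Set.Ioo (-Real.pi) Real.pi, ENNReal.ofReal
        (1 / 2 * (Real.log (1 + |Real.sin (2 * φ)|) - Real.log (Real.sin (2 * φ)))) := by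
  rw [← lintegral_comp_polarCoord_symm, polarCoord_target, Measure.volume_eq_prod,
    ← Measure.prod_restrict, lintegral_prod_symm]
  · refine lintegral_congr_ae ?_
    filter_upwards [ae_restrict_of_ae ae_sin_two_mul_ne_zero] with φ hφ
    exact lintegral_octFiber_ray hφ
  · apply Measurable.aemeasurable
    simp only [smul_eq_mul]
    exact (ENNReal.measurable_ofReal.comp measurable_fst).mul
      (measurable_octFiber.comp continuous_polarCoord_symm.measurable)

theorem intervalIntegrable_log_sub {a b : ℝ} :
    IntervalIntegrable (fun u => Real.log (1 + |Real.sin u|) - Real.log (Real.sin u))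
      volume a b := by
  apply IntervalIntegrable.sub
  · apply Continuous.intervalIntegrable
    exact Continuous.log (by fun_prop) fun u => by positivity
  · exact intervalIntegrable_log_sin

theorem periodic_log_sub :
    Function.Periodic (fun u => Real.log (1 + |Real.sin u|) - Real.log (Real.sin u)) Real.pi := by
  intro u
  simp [Real.sin_add_pi]

theorem integral_log_sub :
    ∫ φ in (-Real.pi)..Real.pi,
        1 / 2 * (Real.log (1 + |Real.sin (2 * φ)|) - Real.log (Real.sin (2 * φ)))
      = 2 * ∫ θ in (0 : ℝ)..(Real.pi / 2), (Real.log (1 + Real.sin θ) - Real.log (Real.cos θ)) := by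
  have hpi := Real.pi_pos
  set f : ℝ → ℝ := fun u => Real.log (1 + |Real.sin u|) - Real.log (Real.sin u) with hf
  have h1 : ∫ φ in (-Real.pi)..Real.pi, 1 / 2 * f (2 * φ) = ∫ u in (0 : ℝ)..Real.pi, f u := by
    rw [intervalIntegral.integral_const_mul,
      intervalIntegral.integral_comp_mul_left f (two_ne_zero), smul_eq_mul]
    -- The interval covers four periods of length `π`, which balances the factor `1/2` in front and
    -- the `1/2` from substituting `u = 2φ`.
    have e : ∫ u in (2 * -Real.pi)..(2 * Real.pi), f u = 4 * ∫ u in (0 : ℝ)..Real.pi, f u := by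
      have := periodic_log_sub.intervalIntegral_add_zsmul_eq 4 (2 * -Real.pi)
        (fun a b => intervalIntegrable_log_sub)
      have e2 := periodic_log_sub.intervalIntegral_add_eq (2 * -Real.pi) 0
      rw [e2, zero_add] at this
      simp only [zsmul_eq_mul] at this
      rw [show 2 * -Real.pi + ((4 : ℤ) : ℝ) * Real.pi = 2 * Real.pi by push_cast; ring] at this
      simpa only [Int.cast_ofNat] using this
    rw [e]
    ring
  have h2 : ∫ u in (0 : ℝ)..Real.pi, f u = 2 * ∫ u in (0 : ℝ)..(Real.pi / 2), f u := by
    rw [← intervalIntegral.integral_add_adjacent_intervals (b := Real.pi / 2)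
      intervalIntegrable_log_sub intervalIntegrable_log_sub]
    have h := intervalIntegral.integral_comp_sub_left (a := 0) (b := Real.pi / 2) f Real.pi
    rw [sub_zero, show Real.pi - Real.pi / 2 = Real.pi / 2 by ring] at h
    rw [← h]
    have e : ∀ u, f (Real.pi - u) = f u := fun u => by simp only [hf, Real.sin_pi_sub]
    simp only [e]
    ring
  have h3 : ∫ u in (0 : ℝ)..(Real.pi / 2), f u
      = ∫ u in (0 : ℝ)..(Real.pi / 2), (Real.log (1 + Real.sin u) - Real.log (Real.sin u)) := by
    apply intervalIntegral.integral_congr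
    intro u hu
    rw [Set.uIcc_of_le (by positivity)] at hu
    simp only [hf]
    rw [abs_of_nonneg (Real.sin_nonneg_of_nonneg_of_le_pi hu.1 (by linarith [hu.2]))]
  have h4 : ∫ u in (0 : ℝ)..(Real.pi / 2), Real.log (Real.sin u)
      = ∫ u in (0 : ℝ)..(Real.pi / 2), Real.log (Real.cos u) := by
    have h := intervalIntegral.integral_comp_sub_left (a := 0) (b := Real.pi / 2)
      (fun u => Real.log (Real.sin u)) (Real.pi / 2)
    simp only [Real.sin_pi_div_two_sub, sub_zero, sub_self] at h
    exact h.symm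
  have hi := intervalIntegrable_log_one_add_sin (a := 0) (b := Real.pi / 2) le_rfl
    (by positivity) (by linarith)
  have hsin : IntervalIntegrable (fun θ => Real.log (Real.sin θ)) volume 0 (Real.pi / 2) :=
    intervalIntegrable_log_sin
  have hcos : IntervalIntegrable (fun θ => Real.log (Real.cos θ)) volume 0 (Real.pi / 2) :=
    intervalIntegrable_log_cos
  rw [h1, h2, h3, intervalIntegral.integral_sub hi hsin, intervalIntegral.integral_sub hi hcos, h4]

/-- The volume of the regular ideal octahedron as a log-trigonometric integral. -/
theorem v₈_eq : v₈
    = 2 * ∫ θ in (0 : ℝ)..(Real.pi / 2), (Real.log (1 + Real.sin θ) - Real.log (Real.cos θ)) := by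
  have hpi := Real.pi_pos
  have hle : -Real.pi ≤ Real.pi := by linarith
  have hnn : ∀ φ : ℝ,
      0 ≤ 1 / 2 * (Real.log (1 + |Real.sin (2 * φ)|) - Real.log (Real.sin (2 * φ))) := by
    intro φ
    rw [← Real.log_abs (Real.sin (2 * φ))]
    rcases (abs_nonneg (Real.sin (2 * φ))).eq_or_lt with h | h
    · rw [← h]; simp
    · have := Real.log_le_log h (by linarith : |Real.sin (2 * φ)| ≤ 1 + |Real.sin (2 * φ)|)
      linarith
  have hi : IntervalIntegrable (fun φ => 1 / 2 *
      (Real.log (1 + |Real.sin (2 * φ)|) - Real.log (Real.sin (2 * φ)))) volume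
      (-Real.pi) Real.pi := by
    have h := (intervalIntegrable_log_sub (a := 2 * -Real.pi) (b := 2 * Real.pi)).comp_mul_left
      (c := 2)
    simp only [mul_div_cancel_left₀ _ (two_ne_zero (α := ℝ))] at h
    exact h.const_mul (1 / 2)
  have hi2 := (intervalIntegrable_iff_integrableOn_Ioc_of_le hle).1 hi
  rw [v₈_eq_lintegral, lintegral_octDensity, lintegral_octFiber,
    setLIntegral_congr Ioo_ae_eq_Ioc,
    ← ofReal_integral_eq_lintegral_ofReal hi2 (Eventually.of_forall hnn),
    ← intervalIntegral.integral_of_le hle, ENNReal.toReal_ofReal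
      (intervalIntegral.integral_nonneg hle fun φ _ => hnn φ), integral_log_sub]

end TwistKnot

theorem lemma5p5 (p : ℕ) (hp : 6 ≤ p) :
    ∃ t₀ s₀ : ℂ, TwistKnot.IsCriticalPoint p t₀ s₀ ∧
      (∀ t s : ℂ, TwistKnot.IsCriticalPoint p t s → t = t₀ ∧ s = s₀) ∧
      2 * Real.pi * (TwistKnot.potential p t₀ s₀).re ≥
        TwistKnot.v₈ - 49 * Real.pi ^ 2 / 64 * (1 / (p : ℝ) ^ 2) := by
  have hP : (6 : ℝ) ≤ p := by exact_mod_cast hp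
  have hN : (23 : ℝ) ≤ 4 * p - 1 := by linarith
  have hpi0 : (Real.pi : ℂ) ≠ 0 := by exact_mod_cast Real.pi_ne_zero
  obtain ⟨θ, hθ, hfix⟩ := TwistKnot.exists_fixedPoint hN
  refine ⟨TwistKnot.curveT θ, 1 / 2 + θ / Real.pi,
    TwistKnot.isCriticalPoint_of_fixedPoint hθ hfix, fun t s h => ?_, ?_⟩
  · obtain ⟨hc, hf, hb⟩ := h.onCurve
    have hθb : |θ.re| ≤ 0.3 * Real.pi := by
      have := Complex.abs_re_le_norm θ
      have := Real.pi_gt_three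
      linarith
    have e : (Real.pi * (s - 1 / 2) : ℂ) = θ := TwistKnot.fixedPoint_unique hN hb hθb hf hfix
    rw [e] at hc
    refine ⟨hc.t_unique (TwistKnot.onCurve_of_norm_le hθ), ?_⟩
    rw [← e]
    field_simp
    ring
  · rw [TwistKnot.v₈_eq, ← TwistKnot.re_curveG_zero]
    exact TwistKnot.re_potential_ge hp hθ hfix
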